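/- Notation. For an integer $b\neq 0$ put $$\mathcal R_b=\varprojlim_k \frac{\mathbb Z[1/b][q]}{\big((q;q^2)_k\big)},\qquad \mathcal S_b=\varprojlim_k \frac{\mathbb Z[1/b][q]}{\big((q;q)_k\big)},$$ where $(x;y)_k=\prod_{j=0}^{k-1}(1-xy^j)$. If $\xi\in\mathbb C$ is a primitive root of unity of odd order, $\mathrm{ev}_\xi:\mathcal R_b\to\mathbb C$ is the evaluation at $q=\xi$. Since $(q;q^2)_k$ divides $(q;q)_{2k}$, there is a natural ring homomorphism $\mathcal S_b\to\mathcal R_b$ (an embedding for odd $b$), and "$Q\in\mathcal S_b$" means that $Q$ lies in its image. For integers $n,k\ge 0$ let $$A(n,k)=\frac{\prod_{i=0}^{k}\left(q^{n}+q^{-n}-q^{i}-q^{-i}\right)}{(1-q)\,(q^{k+1};q)_{k+1}}\in\mathbb Z[q^{\pm1}],\qquad [n]=\frac{q^{n/2}-q^{-n/2}}{q^{1/2}-q^{-1/2}} ,$$ and for a root of unity $\xi$ of odd order $r$ and Laurent polynomials $f(q;n)$ in $q$ let $${\sum_n}^{\xi} f=\sum_{0<n<2r,\ n\text{ odd}}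 f(\xi;n),\qquad F_{U^b}(\xi)={\sum_n}^{\xi} q^{b\frac{n^2-1}{4}}[n]^2 .$$ Theorem. Let $b=\pm1$, or $b=\pm p^l$ with $p$ prime and $l\ge 1$. For every integer $k\ge 0$ there exists an element $Q_{b,k}\in\mathcal R_b$ such that for every primitive root of unity $\xi$ of odd order $r$, where $r>2k+1$ if $k\geq 1$ (that is, where the denominator of $A(n,k)$ does not vanish at $q=\xi$; for $k=0$ every odd $r$ is allowed), one has $F_{U^b}(\xi)\neq 0$ and $$\frac{{\sum\limits_n}^{\xi}\, q^{b\frac{n^2-1}{4}}A(n,k)}{F_{U^b}(\xi)}=\mathrm{ev}_\xi(Q_{b,k}).$$ If in addition $b$ is odd, then $Q_{b,k}\in\mathcal S_b$. -/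

import Mathlib

open Polynomial

namespace LaplaceTransform

noncomputable section

/-! ### `q`-Pochhammer polynomials and cyclotomic completions -/

/-- `(q;q)_k = (1-q)(1-q^2)⋯(1-q^k)` in `R[q]`. -/
def qPoch (R : Type*) [CommRing R] (k : ℕ) : R[X] :=
  ∏ j ∈ Finset.range k, (1 - X ^ (j + 1))

/-- `(q;q^2)_k = (1-q)(1-q^3)⋯(1-q^{2k-1})` in `R[q]`. -/
def qPochOdd (R : Type*) [CommRing R] (k : ℕ) : R[X] :=
  ∏ j ∈ Finset.range k, (1 - X ^ (2 * j + 1))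

theorem qPoch_dvd (R : Type*) [CommRing R] {k m : ℕ} (h : k ≤ m) :
    qPoch R k ∣ qPoch R m :=
  Finset.prod_dvd_prod_of_subset _ _ _ (Finset.range_subset_range.2 h)

theorem qPochOdd_dvd (R : Type*) [CommRing R] {k m : ℕ} (h : k ≤ m) :
    qPochOdd R k ∣ qPochOdd R m :=
  Finset.prod_dvd_prod_of_subset _ _ _ (Finset.range_subset_range.2 h)

theorem qPochOdd_dvd_qPoch (R : Type*) [CommRing R] (k : ℕ) :
    qPochOdd R k ∣ qPoch R (2 * k) := by
  have hinj : Set.InjOn (fun j : ℕ => 2 * j) (Finset.range k : Set ℕ) := by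
    intro a _ c _ h
    simpa using h
  have h : qPochOdd R k
      = ∏ j ∈ (Finset.range k).image (fun j : ℕ => 2 * j), (1 - X ^ (j + 1) : R[X]) := by
    rw [Finset.prod_image hinj]
    rfl
  rw [h]
  apply Finset.prod_dvd_prod_of_subset
  intro j hj
  simp only [Finset.mem_image, Finset.mem_range] at hj ⊢
  omega

/-- The inverse limit `lim_k A / (f k)` over a chain `f 0 ∣ f 1 ∣ ⋯` in a commutative ring `A`,
as the ring of compatible sequences of residue classes. -/
def invLimit {A : Type*} [CommRing A] (f : ℕ → A) (hf : ∀ {k m : ℕ}, k ≤ m → f k ∣ f m) :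
    Subring (∀ k : ℕ, A ⧸ Ideal.span {f k}) where
  carrier := {x | ∀ (k m : ℕ) (h : k ≤ m),
    Ideal.Quotient.factor (Ideal.span_singleton_le_span_singleton.2 (hf h)) (x m) = x k}
  mul_mem' hx hy k m h := by simp [hx k m h, hy k m h]
  one_mem' k m h := by simp
  add_mem' hx hy k m h := by simp [hx k m h, hy k m h]
  zero_mem' k m h := by simp
  neg_mem' hx k m h := by simp [hx k m h]

/-- The ring `ℤ[1/b]`, as a subring of `ℚ`. -/
abbrev ZInv (b : ℤ) : Subalgebra ℤ ℚ := Algebra.adjoin ℤ {(b : ℚ)⁻¹}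

/-- `𝓡_b = lim_k ℤ[1/b][q] / ((q;q^2)_k)`. It depends only on `|b|`. -/
abbrev RRing (b : ℤ) : Subring (∀ k : ℕ, (ZInv b)[X] ⧸ Ideal.span {qPochOdd (ZInv b) k}) :=
  invLimit (qPochOdd (ZInv b)) (qPochOdd_dvd (ZInv b))

/-- `𝓢_b = lim_k ℤ[1/b][q] / ((q;q)_k)`. It depends only on `|b|`. -/
abbrev SRing (b : ℤ) : Subring (∀ k : ℕ, (ZInv b)[X] ⧸ Ideal.span {qPoch (ZInv b) k}) :=
  invLimit (qPoch (ZInv b)) (qPoch_dvd (ZInv b))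

/-- The natural map `𝓢_b → 𝓡_b`, induced by the identity of `ℤ[1/b][q]`; it exists because
`(q;q^2)_k` divides `(q;q)_{2k}`. -/
def sToR (b : ℤ) : SRing b →+* RRing b :=
  RingHom.codRestrict
    (RingHom.pi fun k : ℕ =>
      ((Ideal.Quotient.factor
          (Ideal.span_singleton_le_span_singleton.2 (qPochOdd_dvd_qPoch (ZInv b) k))).comp
        (Pi.evalRingHom _ (2 * k))).comp (SRing b).subtype)
    (RRing b)
    (by
      intro x k m h
      have hx := x.2 (2 * k) (2 * m) (by omega)
      obtain ⟨y, hy⟩ := Ideal.Quotient.mk_surjective (x.1 (2 * m))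
      simp only [RingHom.pi_apply, RingHom.comp_apply, Subring.subtype_apply,
        Pi.evalRingHom_apply]
      rw [← hx, ← hy]
      simp only [Ideal.Quotient.factor_mk])

theorem aeval_qPochOdd {b : ℤ} {ξ : ℂ} {r : ℕ} (hξ : IsPrimitiveRoot ξ r) (hr : Odd r) :
    aeval ξ (qPochOdd (ZInv b) r) = 0 := by
  obtain ⟨m, rfl⟩ := hr
  rw [qPochOdd, map_prod]
  apply Finset.prod_eq_zero (i := m) (Finset.mem_range.2 (by omega))
  simp [hξ.pow_eq_one]

/-- Evaluation `ev_ξ : 𝓡_b → ℂ` at a root of unity `ξ` of odd order `r`. As `(q;q^2)_k` vanishes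
at `ξ` for `2k > r`, the residue class at the index `k = r` has a well-defined value at `ξ`. -/
def evR (b : ℤ) {ξ : ℂ} {r : ℕ} (hξ : IsPrimitiveRoot ξ r) (hr : Odd r) : RRing b →+* ℂ :=
  (Ideal.Quotient.lift (Ideal.span {qPochOdd (ZInv b) r}) (aeval ξ : (ZInv b)[X] →ₐ[ZInv b] ℂ).toRingHom
    (by
      intro a ha
      obtain ⟨c, rfl⟩ := Ideal.mem_span_singleton.1 ha
      have h0 := aeval_qPochOdd (b := b) hξ hr
      simp [h0])).comp
    ((Pi.evalRingHom _ r).comp (RRing b).subtype)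

/-! ### Functions of `q` and evaluation at roots of unity -/

/-- The variable `q` of the field `ℚ(q)` of rational functions. -/
abbrev q : RatFunc ℚ := RatFunc.X

/-- The value at `q = ξ` of a rational function (in lowest terms). It is applied below only to
Laurent polynomials in `q`. -/
def ev (ξ : ℂ) (f : RatFunc ℚ) : ℂ := f.eval (algebraMap ℚ ℂ) ξ

/-- `∑_n^ξ f`: the sum of `ev_ξ f(q;n)` over the odd `n` with `0 < n < 2r`, where `ξ` has
order `r`. -/
def oddSum (ξ : ℂ) (r : ℕ) (f : ℕ → RatFunc ℚ) : ℂ :=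
  ∑ n ∈ (Finset.Ioo 0 (2 * r)).filter Odd, ev ξ (f n)

/-- `A(n,k) = ∏_{i=0}^k (q^n + q^{-n} - q^i - q^{-i}) / ((1-q) (q^{k+1};q)_{k+1})`. -/
def A (n k : ℕ) : RatFunc ℚ :=
  (∏ i ∈ Finset.range (k + 1),
      (q ^ (n : ℤ) + q ^ (-(n : ℤ)) - q ^ (i : ℤ) - q ^ (-(i : ℤ)))) /
    ((1 - q) * ∏ j ∈ Finset.range (k + 1), (1 - q ^ (k + 1) * q ^ j))

/-- The framing factor `q^{b(n^2-1)/4}`, for odd `n` (then `4 ∣ n^2 - 1`). -/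
def framing (b : ℤ) (n : ℕ) : RatFunc ℚ := q ^ (b * (((n : ℤ) ^ 2 - 1) / 4))

/-- The quantum integer `[n] = (q^{n/2} - q^{-n/2}) / (q^{1/2} - q^{-1/2})` for odd `n`,
written without fractional powers as `q^{-(n-1)/2} (1 - q^n) / (1 - q)`. -/
def quantumInt (n : ℕ) : RatFunc ℚ := q ^ (-(((n : ℤ) - 1) / 2)) * ((1 - q ^ n) / (1 - q))

/-- The colored Jones polynomial `J_{U^b}(n) = q^{b(n^2-1)/4} [n]` of the unknot with framing `b`,
for an odd color `n`. -/
def jonesUnknot (b : ℤ) (n : ℕ) : RatFunc ℚ := framing b n * quantumInt n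

/-- `F_{U^b}(ξ) = ∑_n^ξ [n] J_{U^b}(n)` for `ξ` of order `r`. -/
def FUnknot (b : ℤ) (ξ : ℂ) (r : ℕ) : ℂ :=
  oddSum ξ r fun n => quantumInt n * jonesUnknot b n

end

end LaplaceTransform

/-! Summing `q^{b(n²-1)/4} q^{na}` over odd colors is a quadratic Gauss sum. Completing the square
gives `κ·φ(a)`, where `κ ≠ 0` does not depend on `a` and `φ = phase b ξ` is the value at `ξ` of
`q^{-a²/b}` if `c = gcd(|b|, r)` divides `a`, and `0` otherwise (`quadSum_eq_phase`,
`exists_sum_framing_eq`). For `r > 1` the denominator `F_{U^b}(ξ)` is an elementary factor times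
`κ(φ(1) - 1)`, and the `q`-binomial theorem expands `A(n,k)` in powers of `q^n` (`oddSum_A_eq`). So
`κ` cancels, and up to sign and a power of `q` the quotient is `(1-q)/(φ(1)-1)` times `(q;q)_k ∑_a
(-1)^a q^{a(a+1)/2} (φ(a) - φ(a+1)) / ((q;q)_{k-a} (q;q)_{k+1+a})`.

To interpolate these values, `φ(a)` is promoted to the power series `φ(a) e^{-a²h/b}`, an expansion
at `q = ξe^h`. A family of such series is `Realizable` if polynomials over `ℤ[1/b]` match it at
finitely many `ξ` to finite order; it then defines an element of `𝓢_b` (`Realizable.exists_SRing`).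
For fixed `c`, the family `q^{-c²/b}` is a power of `q` times an approximate `|b|/c`-th root of a
power of some `q^{cL}` that is close to `1`. Newton iteration produces the root, since `|b|/c` is
invertible (`realizable_root`). As `|b|` is a prime power, the strata `c = 1, p, p², …` are glued by
the Chinese remainder theorem, `p` being a unit (`Realizable.glue`).

The factors `(q;q)_{k-a} (q;q)_{k+1+a}` still vanish at roots of unity of small order. If
`q^{-a²/b}` is replaced by `q^{m(a²+a)+sa}` with `m` natural, `m` applications of the Bailey lemma
show that the sum is integral (`qFac_mul_baileySum_mem`). The coefficients in `h` depend
polynomially on the exponent, so divisibility for infinitely many `m` extends to `-1/b`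
(`laplaceDen_dvd_sum_character`), and Fourier expansion replaces characters by the periodic function
`φ`. A realizable family that is locally divisible can then be divided (`Realizable.of_mul`). -/

open Polynomial

namespace LaplaceTransform

noncomputable section

/-! ### Gaussian binomials and the Bailey lemma -/

section QSeries

variable {F : Type*} [Field F]

/-- The value `(q;q)_n = (1-q)⋯(1-q^n)` at an element `q` of a field. -/
def qFac (q : F) (n : ℕ) : F := ∏ j ∈ Finset.range n, (1 - q ^ (j + 1))

theorem qFac_succ (q : F) (n : ℕ) : qFac q (n + 1) = qFac q n * (1 - q ^ (n + 1)) :=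
  Finset.prod_range_succ _ _

@[simp] theorem qFac_zero (q : F) : qFac q 0 = 1 := rfl

theorem qFac_mul_prod_Ico (q : F) {i n : ℕ} (h : i ≤ n) :
    qFac q i * ∏ l ∈ Finset.Ico i n, (1 - q ^ (l + 1)) = qFac q n := by
  unfold qFac
  simp only [Finset.range_eq_Ico]
  exact Finset.prod_Ico_consecutive _ (Nat.zero_le i) h

theorem qFac_ne_zero_of_le {q : F} {i n : ℕ} (hn : qFac q n ≠ 0) (h : i ≤ n) : qFac q i ≠ 0 := by
  intro h0
  apply hn
  rw [← qFac_mul_prod_Ico q h, h0, zero_mul]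

theorem one_sub_pow_ne_zero {q : F} {i n : ℕ} (hn : qFac q n ≠ 0) (h : i < n) :
    1 - q ^ (i + 1) ≠ 0 := by
  have := qFac_ne_zero_of_le hn h
  rw [Nat.succ_eq_add_one, qFac_succ] at this
  exact right_ne_zero_of_mul this

/-- The Gaussian binomial coefficient with an arbitrary integer on top. -/
def gaussBinom (q : F) (x : ℤ) (n : ℕ) : F :=
  (∏ l ∈ Finset.range n, (1 - q ^ (x - (l : ℤ)))) / qFac q n

@[simp] theorem gaussBinom_zero_right (q : F) (x : ℤ) : gaussBinom q x 0 = 1 := by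
  simp [gaussBinom]

theorem gaussBinom_succ_num (q : F) (x : ℤ) (n : ℕ) :
    ∏ l ∈ Finset.range (n + 1), (1 - q ^ (x + 1 - (l : ℤ)))
      = (1 - q ^ (x + 1)) * ∏ l ∈ Finset.range n, (1 - q ^ (x - (l : ℤ))) := by
  rw [Finset.prod_range_succ', mul_comm]
  congr 1
  · simp
  · apply Finset.prod_congr rfl
    intro l _
    congr 2
    push_cast
    ring

theorem gaussBinom_pascal {q : F} (hq : q ≠ 0) (x : ℤ) {n : ℕ} (hn : qFac q (n + 1) ≠ 0) :
    gaussBinom q (x + 1) (n + 1)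
      = gaussBinom q x (n + 1) + q ^ (x - (n : ℤ)) * gaussBinom q x n := by
  have h1 : qFac q n ≠ 0 := qFac_ne_zero_of_le hn (Nat.le_succ n)
  have h2 : 1 - q ^ (n + 1) ≠ 0 := one_sub_pow_ne_zero hn (Nat.lt_succ_self n)
  have h3 : q ^ (x + 1) = q ^ (x - (n : ℤ)) * q ^ (n + 1) := by
    rw [← zpow_natCast q (n + 1), ← zpow_add₀ hq]
    congr 1
    push_cast
    ring
  unfold gaussBinom
  rw [gaussBinom_succ_num, Finset.prod_range_succ, qFac_succ, h3]
  field_simp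
  ring

theorem gaussBinom_pascal' {q : F} (hq : q ≠ 0) (x : ℤ) {n : ℕ} (hn : qFac q (n + 1) ≠ 0) :
    gaussBinom q (x + 1) (n + 1)
      = q ^ (n + 1) * gaussBinom q x (n + 1) + gaussBinom q x n := by
  have h1 : qFac q n ≠ 0 := qFac_ne_zero_of_le hn (Nat.le_succ n)
  have h2 : 1 - q ^ (n + 1) ≠ 0 := one_sub_pow_ne_zero hn (Nat.lt_succ_self n)
  have h3 : q ^ (x + 1) = q ^ (x - (n : ℤ)) * q ^ (n + 1) := by
    rw [← zpow_natCast q (n + 1), ← zpow_add₀ hq]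
    congr 1
    push_cast
    ring
  unfold gaussBinom
  rw [gaussBinom_succ_num, Finset.prod_range_succ, qFac_succ, h3]
  field_simp
  ring

theorem gaussBinom_natCast_eq_zero (q : F) {m n : ℕ} (h : m < n) :
    gaussBinom q (m : ℤ) n = 0 := by
  unfold gaussBinom
  rw [Finset.prod_eq_zero (i := m) (Finset.mem_range.2 h) (by simp), zero_div]

theorem gaussBinom_natCast {q : F} {n i : ℕ} (hn : qFac q n ≠ 0) (h : i ≤ n) :
    gaussBinom q (n : ℤ) i = qFac q n / (qFac q i * qFac q (n - i)) := by
  have h1 : qFac q i ≠ 0 := qFac_ne_zero_of_le hn h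
  have h2 : qFac q (n - i) ≠ 0 := qFac_ne_zero_of_le hn (Nat.sub_le n i)
  have h3 : ∏ l ∈ Finset.range i, (1 - q ^ ((n : ℤ) - (l : ℤ)))
      = ∏ l ∈ Finset.Ico (n - i) n, (1 - q ^ (l + 1)) := by
    rw [Finset.prod_Ico_eq_prod_range, Nat.sub_sub_self h, ← Finset.prod_range_reflect]
    apply Finset.prod_congr rfl
    intro l hl
    have := Finset.mem_range.1 hl
    rw [← zpow_natCast]
    congr 2
    omega
  unfold gaussBinom
  rw [h3, ← qFac_mul_prod_Ico q (Nat.sub_le n i)]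
  field_simp

/-- Pascal's rule gives the integrality: induction on `n`, and inside it on `x` in both directions
from `x = 0`. -/
theorem gaussBinom_mem {q : F} (hq : q ≠ 0) (hroot : ∀ n, qFac q n ≠ 0) (B : Subring F)
    (hqB : ∀ x : ℤ, q ^ x ∈ B) (n : ℕ) (x : ℤ) : gaussBinom q x n ∈ B := by
  induction n generalizing x with
  | zero => simp [B.one_mem]
  | succ n ih =>
    induction x with
    | zero =>
      have := gaussBinom_natCast_eq_zero q (Nat.succ_pos n)
      simp only [Nat.cast_zero] at this
      rw [this]
      exact B.zero_mem
    | succ x hx =>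
      rw [gaussBinom_pascal hq _ (hroot _)]
      exact B.add_mem hx (B.mul_mem (hqB _) (ih _))
    | pred x hx =>
      have h := gaussBinom_pascal hq (-(x : ℤ) - 1) (hroot (n + 1))
      rw [sub_add_cancel] at h
      rw [eq_sub_of_add_eq h.symm]
      exact B.sub_mem hx (B.mul_mem (hqB _) (ih _))

/-- The `q`-binomial theorem. -/
theorem prod_one_sub_mul_pow {q : F} (hq : q ≠ 0) (x : F) (n : ℕ) (hn : qFac q n ≠ 0) :
    ∏ l ∈ Finset.range n, (1 - x * q ^ l)
      = ∑ i ∈ Finset.range (n + 1), (-1) ^ i * q ^ (i.choose 2) * gaussBinom q (n : ℤ) i * x ^ i := by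
  induction n with
  | zero => simp
  | succ n ih =>
    have hn' := qFac_ne_zero_of_le hn (Nat.le_succ n)
    rw [Finset.prod_range_succ, ih hn', Finset.sum_range_succ' _ (n + 1), mul_one_sub]
    have e1 : ∀ i ∈ Finset.range (n + 1),
        (-1) ^ (i + 1) * q ^ ((i + 1).choose 2) * gaussBinom q ((n + 1 : ℕ) : ℤ) (i + 1) * x ^ (i + 1)
        = (-1) ^ (i + 1) * q ^ ((i + 1).choose 2) * gaussBinom q (n : ℤ) (i + 1) * x ^ (i + 1)
          - (-1) ^ i * q ^ (i.choose 2) * gaussBinom q (n : ℤ) i * x ^ i * (x * q ^ n) := by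
      intro i hi
      have hi' := Finset.mem_range.1 hi
      have h1 : qFac q (i + 1) ≠ 0 := qFac_ne_zero_of_le hn hi'
      have h2 : q ^ ((n : ℤ) - (i : ℤ)) = q ^ (n - i) := by
        rw [← zpow_natCast]
        congr 1
        omega
      have h3 : q ^ n = q ^ (n - i) * q ^ i := by
        rw [← pow_add]
        congr 1
        omega
      have h4 : (i + 1).choose 2 = i + i.choose 2 := by
        rw [Nat.choose_succ_succ' i 1, Nat.choose_one_right]
      push_cast
      rw [gaussBinom_pascal hq _ h1, h2, h3, h4]
      ring
    rw [Finset.sum_congr rfl e1, Finset.sum_sub_distrib, ← Finset.sum_mul]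
    have e2 := Finset.sum_range_succ'
      (fun i => (-1) ^ i * q ^ (i.choose 2) * gaussBinom q (n : ℤ) i * x ^ i) (n + 1)
    rw [Finset.sum_range_succ, gaussBinom_natCast_eq_zero q (Nat.lt_succ_self n)] at e2
    simp only [mul_zero, zero_mul, add_zero] at e2
    rw [e2]
    simp
    ring

/-- The `q`-binomial theorem for `2k+1` factors, with the terms paired by `a ↔ -1-a`. -/
theorem sum_folded_eq_prod {q x : F} (hq : q ≠ 0) (hx : x ≠ 0) (k : ℕ)
    (hk : qFac q (2 * k + 1) ≠ 0) :
    ∑ a ∈ Finset.range (k + 1), (-1) ^ a * q ^ ((a + 1).choose 2)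
        * (x ^ (a : ℤ) - x ^ (-1 - (a : ℤ))) / (qFac q (k - a) * qFac q (k + 1 + a))
      = (-1) ^ (k + 1) * q ^ ((k + 1).choose 2) * x ^ (-1 - (k : ℤ))
        * ((∏ l ∈ Finset.range (2 * k + 1), (1 - x * q ^ ((l : ℤ) - k))) / qFac q (2 * k + 1)) := by
  have hprod : ∏ l ∈ Finset.range (2 * k + 1), (1 - x * q ^ ((l : ℤ) - k))
      = ∏ l ∈ Finset.range (2 * k + 1), (1 - (x * q ^ (-(k : ℤ))) * q ^ l) := by
    apply Finset.prod_congr rfl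
    intro l _
    rw [mul_assoc, ← zpow_natCast q l, ← zpow_add₀ hq]
    congr 3
    ring
  rw [hprod, prod_one_sub_mul_pow hq _ _ hk, show 2 * k + 1 + 1 = (k + 1) + (k + 1) by ring,
    Finset.sum_range_add (fun i => (-1) ^ i * q ^ (i.choose 2) * gaussBinom q _ i * _ ^ i) (k + 1),
    ← Finset.sum_range_reflect (fun i => (-1) ^ i * q ^ (i.choose 2) * gaussBinom q _ i * _ ^ i)
      (k + 1),
    ← Finset.sum_add_distrib, Finset.sum_div, Finset.mul_sum]
  apply Finset.sum_congr rfl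
  intro a ha
  have ha' : a ≤ k := Nat.lt_succ_iff.1 (Finset.mem_range.1 ha)
  have h1 : qFac q (k - a) ≠ 0 := qFac_ne_zero_of_le hk (by omega)
  have h2 : qFac q (k + 1 + a) ≠ 0 := qFac_ne_zero_of_le hk (by omega)
  rw [show k + 1 - 1 - a = k - a by omega, gaussBinom_natCast hk (by omega),
    gaussBinom_natCast hk (by omega), show 2 * k + 1 - (k - a) = k + 1 + a by omega,
    show 2 * k + 1 - (k + 1 + a) = k - a by omega]
  obtain ⟨d, rfl⟩ := Nat.exists_eq_add_of_le ha'
  have hch : ∀ n : ℕ, (((n + 1).choose 2 : ℕ) : ℤ) * 2 = n * (n + 1) := by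
    intro n
    have h := Finset.sum_range_id_mul_two (n + 1)
    rw [Finset.sum_range_id, ← Nat.choose_two_right, Nat.add_sub_cancel] at h
    rw [mul_comm (n : ℤ)]
    exact_mod_cast h
  -- With `k = a + d`, the terms `i = k+1+a` and `i = k-a` of the expansion at `x q^{-k}` carry the
  -- same power of `q`. This is the symmetry that allows the pairing.
  have key1 : q ^ ((a + 1).choose 2) = q ^ ((a + d + 1).choose 2) * (q ^ ((a + d + 1 + a).choose 2)
      * (q ^ (-((a + d : ℕ) : ℤ))) ^ (a + d + 1 + a)) := by
    simp only [← zpow_natCast q, ← zpow_natCast (q ^ (-((a + d : ℕ) : ℤ))), ← zpow_mul,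
      ← zpow_add₀ hq]
    congr 1
    have e1 := hch a
    have e2 := hch (a + d)
    have e3 := hch (a + d + a)
    rw [show a + d + a + 1 = a + d + 1 + a by ring] at e3
    push_cast at e1 e2 e3 ⊢
    linarith
  have key2 : q ^ ((a + 1).choose 2) = q ^ ((a + d + 1).choose 2) * (q ^ (d.choose 2)
      * (q ^ (-((a + d : ℕ) : ℤ))) ^ d) := by
    simp only [← zpow_natCast q, ← zpow_natCast (q ^ (-((a + d : ℕ) : ℤ))), ← zpow_mul,
      ← zpow_add₀ hq]
    congr 1
    have e1 := hch a
    have e2 := hch (a + d)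
    have e3 := hch d
    rw [Nat.choose_succ_succ' d 1, Nat.choose_one_right] at e3
    push_cast at e1 e2 e3 ⊢
    linarith
  have hx1 : x ^ (a : ℤ) = x ^ (-1 - ((a + d : ℕ) : ℤ)) * x ^ (a + d + 1 + a) := by
    rw [← zpow_natCast x (a + d + 1 + a), ← zpow_add₀ hx]
    congr 1
    push_cast
    ring
  have hx2 : x ^ (-1 - (a : ℤ)) = x ^ (-1 - ((a + d : ℕ) : ℤ)) * x ^ d := by
    rw [← zpow_natCast x d, ← zpow_add₀ hx]
    congr 1
    push_cast
    ring
  have hs1 : (-1 : F) ^ a = (-1) ^ (a + d + 1) * (-1) ^ (a + d + 1 + a) := by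
    rw [← pow_add, show a + d + 1 + (a + d + 1 + a) = 2 * (a + d + 1) + a by ring, pow_add, pow_mul]
    simp
  have hs2 : -(-1 : F) ^ a = (-1) ^ (a + d + 1) * (-1) ^ d := by
    rw [← pow_add, show a + d + 1 + d = 2 * d + (a + 1) by ring, pow_add, pow_mul]
    simp [pow_succ]
  rw [show a + d - a = d by omega] at *
  have t1 : (-1) ^ a * q ^ ((a + 1).choose 2) * x ^ (a : ℤ)
      = ((-1) ^ (a + d + 1) * (-1) ^ (a + d + 1 + a)) * (q ^ ((a + d + 1).choose 2)
        * (q ^ ((a + d + 1 + a).choose 2) * (q ^ (-((a + d : ℕ) : ℤ))) ^ (a + d + 1 + a)))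
        * (x ^ (-1 - ((a + d : ℕ) : ℤ)) * x ^ (a + d + 1 + a)) := by
    rw [← hs1, ← key1, ← hx1]
  have t2 : -(-1) ^ a * q ^ ((a + 1).choose 2) * x ^ (-1 - (a : ℤ))
      = ((-1) ^ (a + d + 1) * (-1) ^ d) * (q ^ ((a + d + 1).choose 2)
        * (q ^ (d.choose 2) * (q ^ (-((a + d : ℕ) : ℤ))) ^ d))
        * (x ^ (-1 - ((a + d : ℕ) : ℤ)) * x ^ d) := by
    rw [← hs2, ← key2, ← hx2]
  rw [mul_sub, sub_eq_add_neg, ← neg_mul, ← neg_mul, t1, t2, mul_pow, mul_pow]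
  field_simp
  ring

/-- Induction on `M` for all `x` at once: in the identity at `xq`, each term is split by `1 = (1 -
xq^{i+1}) + xq^{i+1}`, and Pascal's rule reassembles the two halves into the terms for `M + 1`. -/
theorem sum_gaussBinom_mul_prod_Ico {q : F} (hq : q ≠ 0) (M : ℕ) (hM : qFac q M ≠ 0) (x : F) :
    ∑ i ∈ Finset.range (M + 1), q ^ (i ^ 2) * x ^ i * gaussBinom q (M : ℤ) i
      * ∏ l ∈ Finset.Ico i M, (1 - x * q ^ (l + 1)) = 1 := by
  induction M generalizing x with
  | zero => simp
  | succ M ih =>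
    have hM' := qFac_ne_zero_of_le hM (Nat.le_succ M)
    have hpr : ∀ i, ∏ l ∈ Finset.Ico (i + 1) (M + 1), (1 - x * q ^ (l + 1))
        = ∏ l ∈ Finset.Ico i M, (1 - (x * q) * q ^ (l + 1)) := by
      intro i
      rw [← Finset.prod_Ico_add' _ i M 1]
      apply Finset.prod_congr rfl
      intro l _
      ring
    have key : ∀ i ∈ Finset.range (M + 1),
        q ^ (i ^ 2) * (x * q) ^ i * gaussBinom q (M : ℤ) i
            * ∏ l ∈ Finset.Ico i M, (1 - (x * q) * q ^ (l + 1))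
        = q ^ (i ^ 2) * (x * q) ^ i * gaussBinom q (M : ℤ) i
            * ∏ l ∈ Finset.Ico i (M + 1), (1 - x * q ^ (l + 1))
          + q ^ ((i + 1) ^ 2) * x ^ (i + 1) * gaussBinom q (M : ℤ) i
            * ∏ l ∈ Finset.Ico (i + 1) (M + 1), (1 - x * q ^ (l + 1)) := by
      intro i hi
      rw [Finset.prod_eq_prod_Ico_succ_bot (Finset.mem_range.1 hi), hpr]
      ring
    have h := ih hM' (x * q)
    rw [Finset.sum_congr rfl key, Finset.sum_add_distrib] at h
    refine Eq.trans ?_ h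
    rw [Finset.sum_range_succ']
    have e1 : ∀ i ∈ Finset.range (M + 1),
        q ^ ((i + 1) ^ 2) * x ^ (i + 1) * gaussBinom q ((M + 1 : ℕ) : ℤ) (i + 1)
            * ∏ l ∈ Finset.Ico (i + 1) (M + 1), (1 - x * q ^ (l + 1))
        = q ^ ((i + 1) ^ 2) * (x * q) ^ (i + 1) * gaussBinom q (M : ℤ) (i + 1)
            * ∏ l ∈ Finset.Ico (i + 1) (M + 1), (1 - x * q ^ (l + 1))
          + q ^ ((i + 1) ^ 2) * x ^ (i + 1) * gaussBinom q (M : ℤ) i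
            * ∏ l ∈ Finset.Ico (i + 1) (M + 1), (1 - x * q ^ (l + 1)) := by
      intro i hi
      push_cast
      rw [gaussBinom_pascal' hq _ (qFac_ne_zero_of_le hM (Finset.mem_range.1 hi))]
      ring
    rw [Finset.sum_congr rfl e1, Finset.sum_add_distrib]
    have e2 := Finset.sum_range_succ'
      (fun i => q ^ (i ^ 2) * (x * q) ^ i * gaussBinom q (M : ℤ) i
            * ∏ l ∈ Finset.Ico i (M + 1), (1 - x * q ^ (l + 1))) (M + 1)
    rw [Finset.sum_range_succ, gaussBinom_natCast_eq_zero q (Nat.lt_succ_self M)] at e2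
    simp only [mul_zero, zero_mul, add_zero] at e2
    rw [e2]
    simp
    ring

/-- After `j = a + i` and `M = k - a`, this is the preceding identity at `x = q^{2a+1}`, because `j²
+ j = a² + a + i² + (2a+1)i`. -/
theorem bailey_kernel {q : F} (hq : q ≠ 0) (hroot : ∀ n, qFac q n ≠ 0) {a k : ℕ} (h : a ≤ k) :
    ∑ j ∈ Finset.Ico a (k + 1),
        q ^ (j ^ 2 + j) / (qFac q (k - j) * (qFac q (j - a) * qFac q (j + 1 + a)))
      = q ^ (a ^ 2 + a) / (qFac q (k - a) * qFac q (k + 1 + a)) := by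
  obtain ⟨M, rfl⟩ := Nat.exists_eq_add_of_le h
  have hsum := sum_gaussBinom_mul_prod_Ico hq M (hroot M) (q ^ (2 * a + 1))
  rw [Finset.sum_Ico_eq_sum_range, show a + M + 1 - a = M + 1 by omega,
    show a + M - a = M by omega, ← mul_one (q ^ (a ^ 2 + a)), ← hsum, Finset.mul_sum,
    Finset.sum_div]
  apply Finset.sum_congr rfl
  intro i hi
  have hi' : i ≤ M := Nat.lt_succ_iff.1 (Finset.mem_range.1 hi)
  have hpr : qFac q (a + i + 1 + a) * ∏ l ∈ Finset.Ico i M, (1 - q ^ (2 * a + 1) * q ^ (l + 1))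
      = qFac q (a + M + 1 + a) := by
    rw [← qFac_mul_prod_Ico q (show a + i + 1 + a ≤ a + M + 1 + a by omega),
      show a + i + 1 + a = i + (2 * a + 1) by ring, show a + M + 1 + a = M + (2 * a + 1) by ring,
      ← Finset.prod_Ico_add' _ i M (2 * a + 1)]
    congr 1
    apply Finset.prod_congr rfl
    intro l _
    ring
  have h1 := hroot (a + i + 1 + a)
  have h2 := hroot (a + M + 1 + a)
  have h3 := hroot i
  have h4 := hroot (M - i)
  have h5 := hroot M
  rw [gaussBinom_natCast (hroot M) hi', show a + M - (a + i) = M - i by omega,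
    show a + i - a = i by omega, ← hpr]
  rw [← hpr] at h2
  have h6 := right_ne_zero_of_mul h2
  field_simp
  ring

/-- The Bailey transform `∑_a α_a / ((q;q)_{k-a} (q;q)_{k+1+a})`. -/
def baileySum (q : F) (α : ℕ → F) (k : ℕ) : F :=
  ∑ a ∈ Finset.range (k + 1), α a / (qFac q (k - a) * qFac q (k + 1 + a))

/-- The Bailey lemma. -/
theorem baileySum_mul_pow {q : F} (hq : q ≠ 0) (hroot : ∀ n, qFac q n ≠ 0) (α : ℕ → F) (k : ℕ) :
    baileySum q (fun a => α a * q ^ (a ^ 2 + a)) k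
      = ∑ j ∈ Finset.range (k + 1), q ^ (j ^ 2 + j) / qFac q (k - j) * baileySum q α j := by
  unfold baileySum
  simp_rw [Finset.mul_sum]
  rw [Finset.sum_comm' (t' := Finset.range (k + 1)) (s' := fun a => Finset.Ico a (k + 1))
    (by intro x y; simp only [Finset.mem_range, Finset.mem_Ico]; omega)]
  apply Finset.sum_congr rfl
  intro a ha
  rw [mul_div_assoc, ← bailey_kernel hq hroot (Nat.lt_succ_iff.1 (Finset.mem_range.1 ha)),
    Finset.mul_sum]
  apply Finset.sum_congr rfl
  intro j _
  rw [div_mul_div_comm, mul_comm (α a), div_mul_eq_mul_div]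

/-- For `m = 0` the folded `q`-binomial theorem yields a monomial times a Gaussian binomial. Each
further factor `q^{a²+a}` is absorbed by the Bailey lemma, where the prefactor `(q;q)_k` turns
`1/(q;q)_{k-j}` into a Gaussian binomial times `(q;q)_j`, which is what the induction hypothesis
needs. -/
theorem qFac_mul_baileySum_mem {q : F} (hq : q ≠ 0) (hroot : ∀ n, qFac q n ≠ 0) (B : Subring F)
    (hqB : ∀ x : ℤ, q ^ x ∈ B) (s : ℤ) (m k : ℕ) :
    qFac q k * baileySum q (fun a => (-1) ^ a * q ^ ((a + 1).choose 2)
      * (q ^ (s * (a : ℤ)) - q ^ (s * (-1 - (a : ℤ)))) * (q ^ (a ^ 2 + a)) ^ m) k ∈ B := by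
  have hqB' : ∀ x : ℕ, q ^ x ∈ B := fun x => by simpa using hqB x
  have hfac : ∀ n, qFac q n ∈ B := fun n =>
    B.prod_mem fun j _ => B.sub_mem B.one_mem (hqB' _)
  induction m generalizing k with
  | zero =>
    apply B.mul_mem (hfac k)
    have h := sum_folded_eq_prod hq (zpow_ne_zero s hq) k (hroot _)
    simp only [← zpow_mul] at h
    unfold baileySum
    simp only [pow_zero, mul_one]
    rw [h]
    apply B.mul_mem
    · exact B.mul_mem (B.mul_mem (B.pow_mem (B.neg_mem B.one_mem) _) (hqB' _)) (hqB _)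
    · have hb := gaussBinom_mem hq hroot B hqB (2 * k + 1) (s + k)
      convert hb using 1
      unfold gaussBinom
      rw [← Finset.prod_range_reflect]
      congr 1
      apply Finset.prod_congr rfl
      intro l hl
      have := Finset.mem_range.1 hl
      rw [← zpow_add₀ hq]
      congr 2
      omega
  | succ m ih =>
    simp_rw [pow_succ _ m, ← mul_assoc]
    rw [baileySum_mul_pow hq hroot, Finset.mul_sum]
    apply B.sum_mem
    intro j hj
    have hj' : j ≤ k := Nat.lt_succ_iff.1 (Finset.mem_range.1 hj)
    have hb := gaussBinom_mem hq hroot B hqB j k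
    rw [gaussBinom_natCast (hroot k) hj'] at hb
    have := B.mul_mem (B.mul_mem hb (hqB' (j ^ 2 + j))) (ih j)
    convert this using 1
    have h1 := hroot j
    have h2 := hroot (k - j)
    field_simp

end QSeries

/-! ### Power series expansions at roots of unity -/

section LocalExpansion

/-- The power series `e^{xh}`. -/
def pexp (x : ℂ) : PowerSeries ℂ := PowerSeries.rescale x (PowerSeries.exp ℂ)

theorem pexp_add (x y : ℂ) : pexp (x + y) = pexp x * pexp y :=
  (PowerSeries.exp_mul_exp_eq_exp_add x y).symm

@[simp] theorem coeff_pexp (x : ℂ) (n : ℕ) :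
    PowerSeries.coeff n (pexp x) = x ^ n * ((n.factorial : ℂ))⁻¹ := by
  simp [pexp, PowerSeries.coeff_rescale, PowerSeries.coeff_exp]

@[simp] theorem constantCoeff_pexp (x : ℂ) : PowerSeries.constantCoeff (pexp x) = 1 := by
  rw [← PowerSeries.coeff_zero_eq_constantCoeff_apply, coeff_pexp]
  simp

@[simp] theorem pexp_zero : pexp 0 = 1 := by
  ext n
  rw [coeff_pexp, PowerSeries.coeff_one]
  rcases n with _ | n <;> simp

theorem pexp_pow (x : ℂ) (n : ℕ) : pexp x ^ n = pexp (n * x) := by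
  induction n with
  | zero => simp
  | succ n ih => rw [pow_succ, ih, ← pexp_add]; congr 1; push_cast; ring

/-- The local parameter `ξ e^h` at `ξ`. -/
def localVar (ξ : ℂ) : PowerSeries ℂ := PowerSeries.C ξ * pexp 1

/-- The power `(ξ e^h)^x` with an integer exponent. -/
def localPow (ξ : ℂ) (x : ℤ) : PowerSeries ℂ := PowerSeries.C (ξ ^ x) * pexp x

theorem localPow_add {ξ : ℂ} (hξ : ξ ≠ 0) (x y : ℤ) :
    localPow ξ (x + y) = localPow ξ x * localPow ξ y := by
  unfold localPow
  rw [zpow_add₀ hξ]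
  push_cast
  rw [pexp_add, map_mul]
  ring

theorem localPow_zero (ξ : ℂ) : localPow ξ 0 = 1 := by simp [localPow]

theorem localVar_pow (ξ : ℂ) (n : ℕ) :
    localVar ξ ^ n = PowerSeries.C (ξ ^ n) * pexp n := by
  rw [localVar, mul_pow, pexp_pow, mul_one, map_pow]

theorem localVar_pow_eq_localPow (ξ : ℂ) (n : ℕ) : localVar ξ ^ n = localPow ξ n := by
  simp [localVar_pow, localPow]

theorem pexp_ne_one {x : ℂ} (hx : x ≠ 0) : pexp x ≠ 1 := by
  intro h
  have := congrArg (PowerSeries.coeff 1) h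
  simp [PowerSeries.coeff_one] at this
  exact hx this

theorem localVar_pow_ne_one (ξ : ℂ) {n : ℕ} (hn : n ≠ 0) : localVar ξ ^ n ≠ 1 := by
  rw [localVar_pow]
  intro h
  have h0 := congrArg PowerSeries.constantCoeff h
  simp only [map_mul, PowerSeries.constantCoeff_C, constantCoeff_pexp, mul_one, map_one] at h0
  rw [h0, map_one, one_mul] at h
  exact pexp_ne_one (Nat.cast_ne_zero.2 hn) h

/-- A family of power series whose coefficients are polynomials in the parameter. -/
def PolyDep (f : ℂ → PowerSeries ℂ) : Prop :=
  ∀ i, ∃ p : ℂ[X], ∀ z, PowerSeries.coeff i (f z) = p.eval z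

theorem PolyDep.const (g : PowerSeries ℂ) : PolyDep fun _ => g :=
  fun i => ⟨C (PowerSeries.coeff i g), fun z => by simp⟩

theorem PolyDep.sub {f g : ℂ → PowerSeries ℂ} (hf : PolyDep f) (hg : PolyDep g) :
    PolyDep fun z => f z - g z := by
  intro i
  obtain ⟨p, hp⟩ := hf i
  obtain ⟨s, hs⟩ := hg i
  exact ⟨p - s, fun z => by simp [hp, hs]⟩

theorem PolyDep.mul {f g : ℂ → PowerSeries ℂ} (hf : PolyDep f) (hg : PolyDep g) :
    PolyDep fun z => f z * g z := by
  intro i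
  choose p hp using hf
  choose s hs using hg
  exact ⟨∑ ij ∈ Finset.HasAntidiagonal.antidiagonal i, p ij.1 * s ij.2,
    fun z => by simp [PowerSeries.coeff_mul, hp, hs, Polynomial.eval_finsetSum]⟩

theorem PolyDep.sum {ι : Type*} (s : Finset ι) {f : ι → ℂ → PowerSeries ℂ}
    (hf : ∀ i, PolyDep (f i)) : PolyDep fun z => ∑ i ∈ s, f i z := by
  intro n
  choose p hp using fun i => hf i n
  exact ⟨∑ i ∈ s, p i, fun z => by simp [hp, Polynomial.eval_finsetSum]⟩

theorem PolyDep.pexp (θ ρ : ℂ) : PolyDep fun z => pexp (θ * z + ρ) :=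
  fun i => ⟨(C θ * X + C ρ) ^ i * C ((i.factorial : ℂ))⁻¹, fun z => by simp⟩

theorem exists_associated_X_pow {D : PowerSeries ℂ} (hD : D ≠ 0) :
    ∃ n : ℕ, Associated D (PowerSeries.X ^ n) :=
  IsDiscreteValuationRing.associated_pow_irreducible hD PowerSeries.X_irreducible

/-- Up to a unit `D` is a power of the variable, so divisibility is the vanishing of finitely many
coefficients; each is a polynomial in `z`, zero as soon as it has infinitely many roots. -/
theorem PolyDep.dvd_of_infinite {f : ℂ → PowerSeries ℂ} (hf : PolyDep f) {D : PowerSeries ℂ}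
    (hD : D ≠ 0) {S : Set ℂ} (hS : S.Infinite) (h : ∀ z ∈ S, D ∣ f z) (z : ℂ) : D ∣ f z := by
  obtain ⟨n, hn⟩ := exists_associated_X_pow hD
  rw [hn.dvd_iff_dvd_left, PowerSeries.X_pow_dvd_iff]
  intro i hi
  obtain ⟨p, hp⟩ := hf i
  have hp0 : p = 0 := by
    apply Polynomial.eq_zero_of_infinite_isRoot
    apply hS.mono
    intro w hw
    have := h w hw
    rw [hn.dvd_iff_dvd_left, PowerSeries.X_pow_dvd_iff] at this
    simpa [Polynomial.IsRoot, hp] using this i hi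
  simp [hp, hp0]

end LocalExpansion

/-! ### Local integrality of the Laplace transform -/

section LocalIntegrality

/-- The square of `(u;u)_{2k+1}`. -/
def laplaceDen {R : Type*} [CommRing R] (u : R) (k : ℕ) : R :=
  (∏ l ∈ Finset.range (2 * k + 1), (1 - u ^ (l + 1))) ^ 2

/-- `(-1)^a u^{a(a+1)/2} (u;u)_k / ((u;u)_{k-a} (u;u)_{k+1+a})` multiplied by `laplaceDen u k`. -/
def laplaceNum {R : Type*} [CommRing R] (u : R) (k a : ℕ) : R :=
  (-1) ^ a * u ^ ((a + 1).choose 2) * (∏ j ∈ Finset.range k, (1 - u ^ (j + 1)))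
    * ((∏ l ∈ Finset.Ico (k - a) (2 * k + 1), (1 - u ^ (l + 1)))
      * ∏ l ∈ Finset.Ico (k + 1 + a) (2 * k + 1), (1 - u ^ (l + 1)))

theorem map_laplaceDen {R S : Type*} [CommRing R] [CommRing S] (f : R →+* S) (u : R) (k : ℕ) :
    f (laplaceDen u k) = laplaceDen (f u) k := by
  simp [laplaceDen]

theorem map_laplaceNum {R S : Type*} [CommRing R] [CommRing S] (f : R →+* S) (u : R) (k a : ℕ) :
    f (laplaceNum u k a) = laplaceNum (f u) k a := by
  simp [laplaceNum]

theorem laplaceNum_eq {F : Type*} [Field F] {q : F} {k a : ℕ} (hk : qFac q (2 * k + 1) ≠ 0)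
    (ha : a ≤ k) : laplaceNum q k a = laplaceDen q k * (qFac q k *
      ((-1) ^ a * q ^ ((a + 1).choose 2) / (qFac q (k - a) * qFac q (k + 1 + a)))) := by
  have e1 := qFac_mul_prod_Ico q (show k - a ≤ 2 * k + 1 by omega)
  have e2 := qFac_mul_prod_Ico q (show k + 1 + a ≤ 2 * k + 1 by omega)
  have h1 : qFac q (k - a) ≠ 0 := qFac_ne_zero_of_le hk (by omega)
  have h2 : qFac q (k + 1 + a) ≠ 0 := qFac_ne_zero_of_le hk (by omega)
  have hD : laplaceDen q k = qFac q (2 * k + 1) * qFac q (2 * k + 1) := by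
    rw [laplaceDen, sq]; rfl
  have hN : laplaceNum q k a = (-1) ^ a * q ^ ((a + 1).choose 2) * qFac q k
    * ((∏ l ∈ Finset.Ico (k - a) (2 * k + 1), (1 - q ^ (l + 1)))
      * ∏ l ∈ Finset.Ico (k + 1 + a) (2 * k + 1), (1 - q ^ (l + 1))) := rfl
  rw [hN, hD]
  nth_rewrite 1 [← e1]
  rw [← e2]
  field_simp

theorem localVar_qFac_ne_zero {F : Type*} [Field F] (f : PowerSeries ℂ →+* F)
    (hf : Function.Injective f) (ξ : ℂ) (n : ℕ) : qFac (f (localVar ξ)) n ≠ 0 := by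
  unfold qFac
  rw [Finset.prod_ne_zero_iff]
  intro j _ h
  apply localVar_pow_ne_one ξ (Nat.succ_ne_zero j)
  apply hf
  rw [map_pow, map_one]
  exact (sub_eq_zero.1 h).symm

theorem laplaceDen_localVar_ne_zero (ξ : ℂ) (k : ℕ) : laplaceDen (localVar ξ) k ≠ 0 := by
  unfold laplaceDen
  apply pow_ne_zero
  rw [Finset.prod_ne_zero_iff]
  intro j _ h
  exact localVar_pow_ne_one ξ (Nat.succ_ne_zero j) (sub_eq_zero.1 h).symm

/-- The Bailey integrality is applied in the fraction field of the power series, with the range of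
the embedding as the subring. -/
theorem laplaceDen_dvd_sum_localPow {ξ : ℂ} (hξ : ξ ≠ 0) (k m : ℕ) (s : ℤ) :
    laplaceDen (localVar ξ) k ∣ ∑ a ∈ Finset.range (k + 1), laplaceNum (localVar ξ) k a
      * (localPow ξ (m * ((a : ℤ) ^ 2 + a) + s * a)
        - localPow ξ (m * ((a : ℤ) ^ 2 + a) + s * (-1 - a))) := by
  set f := algebraMap (PowerSeries ℂ) (FractionRing (PowerSeries ℂ)) with hf
  have hinj : Function.Injective f := IsFractionRing.injective _ _
  set q := f (localVar ξ) with hq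
  have hroot : ∀ n, qFac q n ≠ 0 := localVar_qFac_ne_zero f hinj ξ
  have hnat : ∀ n : ℕ, f (localPow ξ n) = q ^ n := by
    intro n
    rw [← localVar_pow_eq_localPow, map_pow]
  have hq0 : q ≠ 0 := by
    intro h
    have h1 : f (localPow ξ (1 : ℕ)) * f (localPow ξ (-1)) = 1 := by
      rw [← map_mul, ← localPow_add hξ]
      simp [localPow_zero]
    rw [hnat, h] at h1
    simp at h1
  have hz : ∀ x : ℤ, f (localPow ξ x) = q ^ x := by
    intro x
    obtain ⟨n, rfl | rfl⟩ := x.eq_nat_or_neg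
    · simpa using hnat n
    · have h1 : f (localPow ξ n) * f (localPow ξ (-n)) = 1 := by
        rw [← map_mul, ← localPow_add hξ]
        simp [localPow_zero]
      rw [hnat] at h1
      rw [zpow_neg, zpow_natCast]
      exact eq_inv_of_mul_eq_one_right h1
  obtain ⟨y, hy⟩ := qFac_mul_baileySum_mem hq0 hroot f.range (fun x => ⟨_, hz x⟩) s m k
  refine ⟨y, hinj ?_⟩
  rw [map_mul, hy, map_laplaceDen, map_sum, baileySum, Finset.mul_sum, Finset.mul_sum]
  apply Finset.sum_congr rfl
  intro a ha
  rw [map_mul, map_laplaceNum, ← hq,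
    laplaceNum_eq (hroot _) (Nat.lt_succ_iff.1 (Finset.mem_range.1 ha)), map_sub, hz, hz,
    zpow_add₀ hq0, zpow_add₀ hq0]
  have h1 : q ^ ((m : ℤ) * ((a : ℤ) ^ 2 + a)) = (q ^ (a ^ 2 + a)) ^ m := by
    rw [← pow_mul, ← zpow_natCast]
    congr 1
    push_cast
    ring
  rw [h1]
  ring

theorem laplaceDen_dvd_sum_character {ξ : ℂ} (hξ : 0 < orderOf ξ) (k : ℕ) {b : ℤ} (hb : b ≠ 0)
    (n : ℤ) : laplaceDen (localVar ξ) k ∣ ∑ a ∈ Finset.range (k + 1), laplaceNum (localVar ξ) k a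
      * (PowerSeries.C (ξ ^ (n * (a : ℤ))) * pexp (-(((a : ℤ) : ℂ) ^ 2 / b))
        - PowerSeries.C (ξ ^ (n * (-1 - (a : ℤ)))) * pexp (-(((-1 - (a : ℤ) : ℤ) : ℂ) ^ 2 / b))) := by
  have hξ0 : ξ ≠ 0 := by
    rintro rfl
    simp at hξ
  have hr := pow_orderOf_eq_one ξ
  set r := orderOf ξ
  -- The linear term `nba·z + na` of the exponent vanishes at `z = -1/b`, leaving `-a²/b`.
  let t : ℂ → ℤ → PowerSeries ℂ := fun z a =>
    PowerSeries.C (ξ ^ (n * a)) * pexp (((a : ℂ) ^ 2 + n * b * a) * z + n * a)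
  have hdep : PolyDep fun z => ∑ a ∈ Finset.range (k + 1), laplaceNum (localVar ξ) k a
      * (t z a - t z (-1 - a)) :=
    PolyDep.sum _ fun a => (PolyDep.const _).mul
      (((PolyDep.const _).mul (PolyDep.pexp _ _)).sub ((PolyDep.const _).mul (PolyDep.pexp _ _)))
  have hbc : (b : ℂ) ≠ 0 := Int.cast_ne_zero.2 hb
  have hS : (Set.range fun m : ℕ => ((r * m : ℕ) : ℂ)).Infinite := by
    apply Set.infinite_range_of_injective
    intro m m' h
    exact Nat.eq_of_mul_eq_mul_left hξ (Nat.cast_injective h)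
  have main := hdep.dvd_of_infinite (laplaceDen_localVar_ne_zero ξ k) hS ?_ (-1 / b)
  · convert main using 6
    · field_simp
      ring
    · field_simp
      ring
  · rintro _ ⟨m, rfl⟩
    -- For `z = rm` the extra power of `ξ` is trivial, so `t z x` is a genuine power of `ξe^h`. The
    -- correction `-rm` in the linear coefficient turns `x²` into `x² + x`, which is invariant under
    -- `x ↔ -1-x`.
    convert laplaceDen_dvd_sum_localPow hξ0 k (r * m) (n * (1 + b * (r * m : ℕ)) - (r * m : ℕ))
      using 3 with a _
    have key : ∀ x : ℤ, t ((r * m : ℕ) : ℂ) x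
        = localPow ξ ((r * m : ℕ) * x ^ 2 + n * (1 + b * (r * m : ℕ)) * x) := by
      intro x
      simp only [t, localPow]
      congr 2
      · rw [show ((r * m : ℕ) : ℤ) * x ^ 2 + n * (1 + b * (r * m : ℕ)) * x
          = n * x + (r : ℤ) * (m * x ^ 2 + n * b * m * x) by push_cast; ring, zpow_add₀ hξ0,
          zpow_mul ξ (r : ℤ), zpow_natCast, hr, one_zpow, mul_one]
      · push_cast
        ring
    rw [key, key]
    congr 2
    · ring
    · ring

/-- A periodic function on `ℤ` is a combination of characters. -/
theorem exists_fourier {ξ : ℂ} (hξ : 0 < orderOf ξ) (φ : ℤ → ℂ)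
    (hφ : ∀ a, φ (a + orderOf ξ) = φ a) :
    ∃ c : ℕ → ℂ, ∀ a, φ a = ∑ n ∈ Finset.range (orderOf ξ), c n * ξ ^ ((n : ℤ) * a) := by
  have hξ0 : ξ ≠ 0 := by
    rintro rfl
    simp at hξ
  have hprim := IsPrimitiveRoot.orderOf ξ
  set r := orderOf ξ with hr
  have hr0 : (r : ℂ) ≠ 0 := Nat.cast_ne_zero.2 hξ.ne'
  have hper : Function.Periodic φ (r : ℤ) := hφ
  have horth : ∀ x : ℤ, ∑ n ∈ Finset.range r, ξ ^ ((n : ℤ) * x)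
      = if (r : ℤ) ∣ x then (r : ℂ) else 0 := by
    intro x
    have e : ∀ n ∈ Finset.range r, ξ ^ ((n : ℤ) * x) = (ξ ^ x) ^ n := by
      intro n _
      rw [mul_comm, zpow_mul, zpow_natCast]
    rw [Finset.sum_congr rfl e]
    split_ifs with h
    · rw [(hprim.zpow_eq_one_iff_dvd x).2 h]
      simp
    · have h1 : ξ ^ x ≠ 1 := fun h' => h ((hprim.zpow_eq_one_iff_dvd x).1 h')
      have h2 := mul_geom_sum (ξ ^ x) r
      rw [← zpow_natCast, ← zpow_mul, mul_comm x, zpow_mul, zpow_natCast, hprim.pow_eq_one,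
        one_zpow, sub_self] at h2
      exact (mul_eq_zero.1 h2).resolve_left (sub_ne_zero.2 h1)
  refine ⟨fun n => (r : ℂ)⁻¹ * ∑ d ∈ Finset.range r, φ d * ξ ^ ((n : ℤ) * (-(d : ℤ))), fun a => ?_⟩
  have h1 : ∑ n ∈ Finset.range r, ((r : ℂ)⁻¹ * ∑ d ∈ Finset.range r,
      φ d * ξ ^ ((n : ℤ) * (-(d : ℤ)))) * ξ ^ ((n : ℤ) * a)
      = (r : ℂ)⁻¹ * ∑ d ∈ Finset.range r, φ d * ∑ n ∈ Finset.range r, ξ ^ ((n : ℤ) * (a - d)) := by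
    simp_rw [Finset.mul_sum, Finset.sum_mul]
    rw [Finset.sum_comm]
    apply Finset.sum_congr rfl
    intro d _
    apply Finset.sum_congr rfl
    intro n _
    rw [show (n : ℤ) * (a - d) = n * (-d) + n * a by ring, zpow_add₀ hξ0]
    ring
  rw [h1]
  simp_rw [horth]
  have hr' : (0 : ℤ) < r := by exact_mod_cast hξ
  have hnn := Int.emod_nonneg a hr'.ne'
  have hlt := Int.emod_lt_of_pos a hr'
  rw [Finset.sum_eq_single (a % r).toNat]
  · have hd : ((a % r).toNat : ℤ) = a % r := Int.toNat_of_nonneg hnn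
    rw [hd, if_pos (Int.dvd_self_sub_emod)]
    have h3 : φ (a % r) = φ a := by
      have := hper.int_mul (a / r) (a % r)
      rw [← this]
      congr 1
      have := Int.emod_add_mul_ediv a r
      push_cast
      linarith
    rw [h3]
    field_simp
  · intro d hd hne
    rw [if_neg, mul_zero]
    intro hdvd
    apply hne
    have h4 : (d : ℤ) % r = a % r := Int.ModEq.symm ((Int.modEq_iff_dvd.2 (by
      rw [← neg_sub]; exact (Int.dvd_neg).2 hdvd)))
    have h5 : (d : ℤ) % r = d := Int.emod_eq_of_lt (Int.natCast_nonneg d)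
      (by exact_mod_cast Finset.mem_range.1 hd)
    omega
  · intro h
    exfalso
    apply h
    rw [Finset.mem_range]
    omega

theorem laplaceDen_dvd_sum_periodic {ξ : ℂ} (hξ : 0 < orderOf ξ) (k : ℕ) {b : ℤ} (hb : b ≠ 0)
    (φ : ℤ → ℂ) (hφ : ∀ a, φ (a + orderOf ξ) = φ a) :
    laplaceDen (localVar ξ) k ∣ ∑ a ∈ Finset.range (k + 1), laplaceNum (localVar ξ) k a
      * (PowerSeries.C (φ a) * pexp (-(((a : ℤ) : ℂ) ^ 2 / b))
        - PowerSeries.C (φ (-1 - a)) * pexp (-(((-1 - (a : ℤ) : ℤ) : ℂ) ^ 2 / b))) := by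
  obtain ⟨c, hc⟩ := exists_fourier hξ φ hφ
  have h : ∑ a ∈ Finset.range (k + 1), laplaceNum (localVar ξ) k a
      * (PowerSeries.C (φ a) * pexp (-(((a : ℤ) : ℂ) ^ 2 / b))
        - PowerSeries.C (φ (-1 - a)) * pexp (-(((-1 - (a : ℤ) : ℤ) : ℂ) ^ 2 / b)))
      = ∑ n ∈ Finset.range (orderOf ξ), PowerSeries.C (c n) *
        ∑ a ∈ Finset.range (k + 1), laplaceNum (localVar ξ) k a
      * (PowerSeries.C (ξ ^ ((n : ℤ) * (a : ℤ))) * pexp (-(((a : ℤ) : ℂ) ^ 2 / b))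
        - PowerSeries.C (ξ ^ ((n : ℤ) * (-1 - (a : ℤ))))
          * pexp (-(((-1 - (a : ℤ) : ℤ) : ℂ) ^ 2 / b))) := by
    simp_rw [Finset.mul_sum]
    rw [Finset.sum_comm]
    apply Finset.sum_congr rfl
    intro a _
    rw [hc, hc, map_sum, map_sum, Finset.sum_mul, Finset.sum_mul, ← Finset.sum_sub_distrib,
      Finset.mul_sum]
    apply Finset.sum_congr rfl
    intro n _
    rw [map_mul, map_mul]
    ring
  rw [h]
  exact Finset.dvd_sum fun n _ => Dvd.dvd.mul_left (laplaceDen_dvd_sum_character hξ k hb n) _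

end LocalIntegrality

/-! ### Divisibility of polynomials and local expansions -/

/-- A polynomial that is associated to a monic one. -/
def AssocMonic {R : Type*} [CommRing R] (f : R[X]) : Prop := ∃ g : R[X], g.Monic ∧ Associated f g

theorem AssocMonic.mul {R : Type*} [CommRing R] {f g : R[X]} (hf : AssocMonic f) (hg : AssocMonic g) :
    AssocMonic (f * g) := by
  obtain ⟨f', hf', hff⟩ := hf
  obtain ⟨g', hg', hgg⟩ := hg
  exact ⟨f' * g', hf'.mul hg', hff.mul_mul hgg⟩

theorem assocMonic_prod {R : Type*} [CommRing R] (n : ℕ) :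
    AssocMonic (∏ j ∈ Finset.range n, (1 - X ^ (j + 1) : R[X])) := by
  apply Finset.prod_induction _ AssocMonic (fun _ _ => AssocMonic.mul)
    ⟨1, monic_one, Associated.refl _⟩
  intro j _
  refine ⟨X ^ (j + 1) - 1, ?_, ?_⟩
  · simpa using monic_X_pow_sub_C (1 : R) (Nat.succ_ne_zero j)
  · rw [← neg_sub]
    exact Associated.neg_left (Associated.refl _)

section LocalExp

variable {R : Type*} [CommRing R] [Algebra R ℂ]

/-- The expansion of a polynomial in `h` at `q = ξ e^h`. -/
def localExp (ξ : ℂ) : R[X] →+* PowerSeries ℂ :=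
  eval₂RingHom ((PowerSeries.C).comp (algebraMap R ℂ)) (localVar ξ)

@[simp] theorem localExp_X (ξ : ℂ) : localExp ξ (X : R[X]) = localVar ξ := by
  simp [localExp]

theorem constantCoeff_localExp (ξ : ℂ) (P : R[X]) :
    PowerSeries.constantCoeff (localExp ξ P) = aeval ξ P := by
  have h : (PowerSeries.constantCoeff.comp (localExp ξ) : R[X] →+* ℂ)
      = (aeval ξ : R[X] →ₐ[R] ℂ).toRingHom := by
    apply Polynomial.ringHom_ext
    · intro a
      simp [localExp]
    · simp [localExp, localVar]
  exact congrArg (fun f => f P) h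

theorem localExp_map (ξ : ℂ) (P : R[X]) :
    localExp ξ (P.map (algebraMap R ℂ)) = localExp ξ P := by
  simp [localExp, Polynomial.eval₂_map]

theorem X_dvd_localExp {ξ : ℂ} {P : R[X]} (h : aeval ξ P = 0) :
    PowerSeries.X ∣ localExp ξ P := by
  rw [PowerSeries.X_dvd_iff, constantCoeff_localExp, h]

theorem localExp_X_sub_C_associated {ξ : ℂ} (hξ : ξ ≠ 0) :
    Associated (localExp ξ (X - C ξ : ℂ[X])) PowerSeries.X := by
  obtain ⟨u, hu⟩ := X_dvd_localExp (ξ := ξ) (P := (X - C ξ : ℂ[X])) (by simp)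
  have hc : PowerSeries.coeff 1 (localExp ξ (X - C ξ : ℂ[X])) = ξ := by
    simp [localExp, localVar]
  rw [hu, show (1 : ℕ) = 0 + 1 from rfl, PowerSeries.coeff_succ_X_mul] at hc
  have hunit : IsUnit u := by
    rw [PowerSeries.isUnit_iff_constantCoeff]
    rw [PowerSeries.coeff_zero_eq_constantCoeff_apply] at hc
    rw [hc]
    exact hξ.isUnit
  rw [hu]
  exact (associated_mul_unit_left _ _ hunit)

/-- The order of vanishing in `h` is the root multiplicity, since `ξe^h - ξ` has a simple zero. -/
theorem localExp_associated {ξ : ℂ} (hξ : ξ ≠ 0) {P : ℂ[X]} (hP : P ≠ 0) :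
    Associated (localExp ξ P) (PowerSeries.X ^ (P.rootMultiplicity ξ)) := by
  obtain ⟨Q, hQ, hndvd⟩ := exists_eq_pow_rootMultiplicity_mul_and_not_dvd P hP ξ
  have hunit : IsUnit (localExp ξ Q) := by
    rw [PowerSeries.isUnit_iff_constantCoeff, constantCoeff_localExp]
    rw [dvd_iff_isRoot] at hndvd
    simpa [Polynomial.aeval_def, Polynomial.IsRoot] using hndvd
  have h := congrArg (localExp ξ) hQ
  rw [map_mul, map_pow] at h
  rw [h]
  exact (associated_mul_unit_left _ _ hunit).trans ((localExp_X_sub_C_associated hξ).pow_pow)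

/-- Divisibility by a product of cyclotomic polynomials may be checked locally. -/
theorem dvd_of_localExp_dvd (hinj : Function.Injective (algebraMap R ℂ)) {f P : R[X]}
    (hf : AssocMonic f)
    (h : ∀ ξ : ℂ, aeval ξ f = 0 → ξ ≠ 0 ∧ localExp ξ f ∣ localExp ξ P) : f ∣ P := by
  obtain ⟨g, hg, hfg⟩ := hf
  rw [hfg.dvd_iff_dvd_left, ← Polynomial.map_dvd_map _ hinj hg]
  rcases eq_or_ne (P.map (algebraMap R ℂ)) 0 with hP | hP
  · rw [hP]
    exact dvd_zero _
  have hgm : (g.map (algebraMap R ℂ)).Monic := hg.map _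
  have hg0 := hgm.ne_zero
  have hsplit := (IsAlgClosed.splits (g.map (algebraMap R ℂ))).eq_prod_roots_of_monic hgm
  rw [hsplit, Multiset.prod_X_sub_C_dvd_iff_le_roots hP, Multiset.le_iff_count]
  intro ξ
  rw [count_roots, count_roots]
  by_cases hroot : (g.map (algebraMap R ℂ)).IsRoot ξ
  · have hev : aeval ξ g = 0 := by
      simpa [Polynomial.IsRoot, Polynomial.eval_map, Polynomial.aeval_def] using hroot
    obtain ⟨u, hu⟩ := hfg.symm
    obtain ⟨hξ, hdvd⟩ := h ξ (by rw [← hu, map_mul, hev, zero_mul])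
    have hgf : localExp ξ g ∣ localExp ξ f := by
      rw [← hu, map_mul]
      exact dvd_mul_right _ _
    have hdvd' : localExp ξ g ∣ localExp ξ P := hgf.trans hdvd
    rw [← localExp_map ξ g, ← localExp_map ξ P,
      (localExp_associated hξ hg0).dvd_iff_dvd_left,
      (localExp_associated hξ hP).dvd_iff_dvd_right] at hdvd'
    exact (pow_dvd_pow_iff PowerSeries.X_ne_zero PowerSeries.X_irreducible.not_isUnit).1 hdvd'
  · rw [rootMultiplicity_eq_zero hroot]
    exact Nat.zero_le _

/-- The zeros of `1 - q^n` at roots of unity are simple. -/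
theorem localVar_factor_dvd_X (ξ : ℂ) {n : ℕ} (hn : n ≠ 0) :
    (1 - localVar ξ ^ n) ∣ PowerSeries.X := by
  by_cases h : ξ ^ n = 1
  · have hX : PowerSeries.X ∣ 1 - localVar ξ ^ n := by
      rw [PowerSeries.X_dvd_iff, localVar_pow]
      simp [h]
    obtain ⟨u, hu⟩ := hX
    have hc : PowerSeries.coeff 1 (1 - localVar ξ ^ n) = -(n : ℂ) := by
      simp [localVar_pow, h, PowerSeries.coeff_one]
    rw [hu, show (1 : ℕ) = 0 + 1 from rfl, PowerSeries.coeff_succ_X_mul] at hc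
    have hunit : IsUnit u := by
      rw [PowerSeries.isUnit_iff_constantCoeff]
      rw [PowerSeries.coeff_zero_eq_constantCoeff_apply] at hc
      rw [hc]
      exact (neg_ne_zero.2 (Nat.cast_ne_zero.2 hn)).isUnit
    rw [hu]
    exact (associated_mul_unit_left _ _ hunit).dvd
  · have hunit : IsUnit (1 - localVar ξ ^ n) := by
      rw [PowerSeries.isUnit_iff_constantCoeff, localVar_pow]
      simpa using sub_ne_zero.2 (Ne.symm h)
    exact hunit.dvd

theorem localVar_prod_dvd_X_pow (ξ : ℂ) (n : ℕ) :
    (∏ j ∈ Finset.range n, (1 - localVar ξ ^ (j + 1))) ∣ PowerSeries.X ^ n := by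
  have := Finset.prod_dvd_prod_of_dvd (s := Finset.range n) (fun j => 1 - localVar ξ ^ (j + 1))
    (fun _ => PowerSeries.X) (fun j _ => localVar_factor_dvd_X ξ (Nat.succ_ne_zero j))
  simpa using this

theorem orderOf_of_aeval_prod {ξ : ℂ} {n : ℕ}
    (h : aeval ξ (∏ j ∈ Finset.range n, (1 - X ^ (j + 1) : R[X])) = 0) :
    0 < orderOf ξ ∧ orderOf ξ ≤ n := by
  rw [map_prod, Finset.prod_eq_zero_iff] at h
  obtain ⟨j, hj, h0⟩ := h
  have h1 : ξ ^ (j + 1) = 1 := by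
    simp only [map_sub, map_one, map_pow, aeval_X] at h0
    exact (sub_eq_zero.1 h0).symm
  have := Finset.mem_range.1 hj
  exact ⟨orderOf_pos_iff.2 (isOfFinOrder_iff_pow_eq_one.2 ⟨j + 1, Nat.succ_pos j, h1⟩),
    (orderOf_le_of_pow_eq_one (Nat.succ_pos j) h1).trans this⟩

theorem ne_zero_of_orderOf_pos {ξ : ℂ} (h : 0 < orderOf ξ) : ξ ≠ 0 := by
  rintro rfl
  simp at h

end LocalExp

/-! ### Families of power series interpolated by polynomials -/

section Realizable

variable {R : Type*} [CommRing R] [Algebra R ℂ]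

/-- The family `G ξ`, for roots of unity `ξ` with order in `S`, is approximated by the expansions
of polynomials with coefficients in `R`, at finitely many roots of unity and to finite order
at a time. -/
def Realizable (R : Type*) [CommRing R] [Algebra R ℂ] (S : Set ℕ) (G : ℂ → PowerSeries ℂ) : Prop :=
  ∀ M K : ℕ, ∃ P : R[X], ∀ ξ : ℂ, 0 < orderOf ξ → orderOf ξ ≤ K → orderOf ξ ∈ S →
    PowerSeries.X ^ M ∣ localExp ξ P - G ξ

theorem Realizable.congr {S : Set ℕ} {G H : ℂ → PowerSeries ℂ} (hG : Realizable R S G)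
    (h : ∀ ξ, 0 < orderOf ξ → orderOf ξ ∈ S → G ξ = H ξ) : Realizable R S H := by
  intro M K
  obtain ⟨P, hP⟩ := hG M K
  exact ⟨P, fun ξ h0 hK hS => h ξ h0 hS ▸ hP ξ h0 hK hS⟩

theorem Realizable.mono {S T : Set ℕ} {G : ℂ → PowerSeries ℂ} (hG : Realizable R T G)
    (h : ∀ r, 0 < r → r ∈ S → r ∈ T) : Realizable R S G := by
  intro M K
  obtain ⟨P, hP⟩ := hG M K
  exact ⟨P, fun ξ h0 hK hS => hP ξ h0 hK (h _ h0 hS)⟩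

theorem realizable_localExp (S : Set ℕ) (P : R[X]) : Realizable R S fun ξ => localExp ξ P :=
  fun M K => ⟨P, fun ξ _ _ _ => by simp⟩

theorem realizable_zero (S : Set ℕ) : Realizable R S fun _ => 0 :=
  fun M K => ⟨0, fun ξ _ _ _ => by simp⟩

theorem realizable_one (S : Set ℕ) : Realizable R S fun _ => 1 :=
  fun M K => ⟨1, fun ξ _ _ _ => by simp⟩

theorem Realizable.add {S : Set ℕ} {G H : ℂ → PowerSeries ℂ} (hG : Realizable R S G)
    (hH : Realizable R S H) : Realizable R S fun ξ => G ξ + H ξ := by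
  intro M K
  obtain ⟨P, hP⟩ := hG M K
  obtain ⟨Q, hQ⟩ := hH M K
  refine ⟨P + Q, fun ξ h0 hK hS => ?_⟩
  rw [map_add, add_sub_add_comm]
  exact dvd_add (hP ξ h0 hK hS) (hQ ξ h0 hK hS)

theorem Realizable.mul {S : Set ℕ} {G H : ℂ → PowerSeries ℂ} (hG : Realizable R S G)
    (hH : Realizable R S H) : Realizable R S fun ξ => G ξ * H ξ := by
  intro M K
  obtain ⟨P, hP⟩ := hG M K
  obtain ⟨Q, hQ⟩ := hH M K
  refine ⟨P * Q, fun ξ h0 hK hS => ?_⟩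
  rw [map_mul, show localExp ξ P * localExp ξ Q - G ξ * H ξ
    = localExp ξ P * (localExp ξ Q - H ξ) + (localExp ξ P - G ξ) * H ξ by ring]
  exact dvd_add (Dvd.dvd.mul_left (hQ ξ h0 hK hS) _) (Dvd.dvd.mul_right (hP ξ h0 hK hS) _)

theorem Realizable.neg {S : Set ℕ} {G : ℂ → PowerSeries ℂ} (hG : Realizable R S G) :
    Realizable R S fun ξ => -G ξ := by
  refine ((realizable_localExp S (-1 : R[X])).mul hG).congr fun _ _ _ => ?_
  simp

theorem Realizable.sub {S : Set ℕ} {G H : ℂ → PowerSeries ℂ} (hG : Realizable R S G)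
    (hH : Realizable R S H) : Realizable R S fun ξ => G ξ - H ξ :=
  (hG.add hH.neg).congr fun _ _ _ => (sub_eq_add_neg _ _).symm

theorem Realizable.pow {S : Set ℕ} {G : ℂ → PowerSeries ℂ} (hG : Realizable R S G) (n : ℕ) :
    Realizable R S fun ξ => G ξ ^ n := by
  induction n with
  | zero => exact (realizable_one S).congr fun ξ _ _ => (pow_zero _).symm
  | succ n ih => exact (ih.mul hG).congr fun _ _ _ => (pow_succ _ _).symm

theorem Realizable.sum {ι : Type*} (s : Finset ι) {S : Set ℕ} {G : ι → ℂ → PowerSeries ℂ}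
    (hG : ∀ i ∈ s, Realizable R S (G i)) : Realizable R S fun ξ => ∑ i ∈ s, G i ξ := by
  classical
  induction s using Finset.induction_on with
  | empty => exact (realizable_zero S).congr fun ξ _ _ => by simp
  | insert i s hi ih =>
    refine ((hG i (Finset.mem_insert_self i s)).add
      (ih fun j hj => hG j (Finset.mem_insert_of_mem hj))).congr fun ξ _ _ => ?_
    rw [Finset.sum_insert hi]

/-- Families on roots of unity with order prime to `p^{j+1}` and on those with order divisible by
`p^{j+1}` can be glued when `p` is invertible. -/
theorem Realizable.glue {p : ℕ} (hp : p.Prime) (hu : IsUnit (p : R)) (j : ℕ) {S : Set ℕ}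
    {G : ℂ → PowerSeries ℂ} (h1 : Realizable R {r | ¬ p ^ (j + 1) ∣ r ∧ r ∈ S} G)
    (h2 : Realizable R {r | p ^ (j + 1) ∣ r ∧ r ∈ S} G) : Realizable R S G := by
  intro M K
  obtain ⟨P, hP⟩ := h1 M K
  obtain ⟨Q, hQ⟩ := h2 M K
  obtain ⟨t, L, hL, hK⟩ := Nat.exists_eq_pow_mul_and_not_dvd (Nat.factorial_ne_zero K) p
    hp.ne_one
  -- Among orders at most `K`, those not divisible by `p^{j+1}` divide `L p^j`, so `Y = 1` there. At
  -- the others `Y ≠ 1` but `Y^{p^t} = 1`, so `Φ = 0`.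
  set Y : R[X] := X ^ (L * p ^ j) with hY
  set Φ : R[X] := ∑ i ∈ Finset.range (p ^ t), Y ^ i with hΦ
  -- Modulo `Y - 1` the sum `Φ` is the unit `p^t`.
  have hcop : IsCoprime (Y - 1) Φ := by
    have hd : (Y - 1) ∣ Φ - C ((p : R) ^ t) := by
      have : Φ - C ((p : R) ^ t) = ∑ i ∈ Finset.range (p ^ t), (Y ^ i - 1) := by
        simp [hΦ]
      rw [this]
      exact Finset.dvd_sum fun i _ => sub_one_dvd_pow_sub_one _ _
    obtain ⟨Z, hZ⟩ := hd
    obtain ⟨v, hv⟩ := (hu.pow t).exists_left_inv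
    refine ⟨-(C v * Z), C v, ?_⟩
    have : Φ = (Y - 1) * Z + C ((p : R) ^ t) := by rw [← hZ]; ring
    rw [this, mul_add, ← C_mul, hv, C_1]
    ring
  obtain ⟨A, B, hAB⟩ := (hcop.pow (m := M) (n := M))
  have hfac : ∀ ξ : ℂ, 0 < orderOf ξ → orderOf ξ ≤ K → orderOf ξ ∣ p ^ t * L := by
    intro ξ h0 hle
    rw [← hK]
    exact Nat.dvd_factorial h0 hle
  have hLp : Nat.Coprime p L := (Nat.Prime.coprime_iff_not_dvd hp).2 hL
  refine ⟨P + A * (Y - 1) ^ M * (Q - P), fun ξ h0 hle hS => ?_⟩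
  by_cases hdiv : p ^ (j + 1) ∣ orderOf ξ
  · have hΦ0 : aeval ξ Φ = 0 := by
      have hne : ξ ^ (L * p ^ j) ≠ 1 := by
        intro h
        have h' := dvd_trans hdiv (orderOf_dvd_of_pow_eq_one h)
        rw [pow_succ, mul_comm L] at h'
        exact hL (Nat.dvd_of_mul_dvd_mul_left (pow_pos hp.pos j) h')
      have hone : (ξ ^ (L * p ^ j)) ^ (p ^ t) = 1 := by
        rw [← pow_mul]
        apply orderOf_dvd_iff_pow_eq_one.1
        refine (hfac ξ h0 hle).trans ⟨p ^ j, by ring⟩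
      have hg := mul_geom_sum (ξ ^ (L * p ^ j)) (p ^ t)
      rw [hone, sub_self] at hg
      have := (mul_eq_zero.1 hg).resolve_left (sub_ne_zero.2 hne)
      simpa [hΦ, hY] using this
    have hdvd : PowerSeries.X ^ M ∣ localExp ξ (B * Φ ^ M) := by
      rw [map_mul, map_pow]
      exact Dvd.dvd.mul_left (pow_dvd_pow_of_dvd (X_dvd_localExp hΦ0) M) _
    have e : P + A * (Y - 1) ^ M * (Q - P) = Q - B * Φ ^ M * (Q - P) := by
      rw [eq_sub_of_add_eq hAB]
      ring
    rw [e, map_sub, map_mul, sub_right_comm]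
    exact dvd_sub (hQ ξ h0 hle ⟨hdiv, hS⟩) (Dvd.dvd.mul_right hdvd _)
  · have hY0 : aeval ξ (Y - 1) = 0 := by
      have : orderOf ξ ∣ L * p ^ j := by
        have hord : orderOf ξ ≠ 0 := h0.ne'
        obtain ⟨i, s, hs, hr⟩ := Nat.exists_eq_pow_mul_and_not_dvd hord p hp.ne_one
        rw [hr]
        have hij : i ≤ j := by
          by_contra hcon
          apply hdiv
          rw [hr]
          exact Dvd.dvd.mul_right (pow_dvd_pow p (by omega)) s
        have hsL : s ∣ L := by
          have h3 : s ∣ p ^ t * L := dvd_trans ⟨p ^ i, by rw [hr]; ring⟩ (hfac ξ h0 hle)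
          exact Nat.Coprime.dvd_of_dvd_mul_left
            (((Nat.Prime.coprime_iff_not_dvd hp).2 hs).symm.pow_right t) h3
        rw [mul_comm]
        exact mul_dvd_mul hsL (pow_dvd_pow p hij)
      simp [hY, orderOf_dvd_iff_pow_eq_one.1 this]
    have hdvd : PowerSeries.X ^ M ∣ localExp ξ (A * (Y - 1) ^ M) := by
      rw [map_mul, map_pow]
      exact Dvd.dvd.mul_left (pow_dvd_pow_of_dvd (X_dvd_localExp hY0) M) _
    rw [map_add, map_mul, add_sub_right_comm]
    exact dvd_add (hP ξ h0 hle ⟨hdiv, hS⟩) (Dvd.dvd.mul_right hdvd _)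

/-- An approximate `n`-th root of `X^{-s}` near `X = 1`. -/
theorem exists_approx_root {R : Type*} [CommRing R] {n : ℕ} (hn : IsUnit (n : R)) (s M : ℕ) :
    ∃ g : R[X], g.eval 1 = 1 ∧ (X - 1) ^ (M + 1) ∣ g ^ n * X ^ s - 1 := by
  induction M with
  | zero => exact ⟨1, by simp, by simpa using sub_one_dvd_pow_sub_one (X : R[X]) s⟩
  | succ M ih =>
    obtain ⟨g, hg1, d, hd⟩ := ih
    obtain ⟨v, hv⟩ := hn.exists_left_inv
    -- Newton step: `d(1) + nt = 0`, so the new error vanishes to one more order at `1`.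
    set t : R := -(v * d.eval 1) with ht
    obtain ⟨e, he⟩ := powAddExpansion g (C t * (X - 1) ^ (M + 1)) n
    refine ⟨g + C t * (X - 1) ^ (M + 1), by simp [hg1], ?_⟩
    have h1 : (g + C t * (X - 1) ^ (M + 1)) ^ n * X ^ s - 1
        = (X - 1) ^ (M + 1) * (d + (n : R[X]) * g ^ (n - 1) * C t * X ^ s
          + e * C t ^ 2 * (X - 1) ^ (M + 1) * X ^ s) := by
      rw [he, mul_add, mul_add, ← hd]
      ring
    rw [h1, pow_succ]
    apply mul_dvd_mul_left
    rw [← C_1, dvd_iff_isRoot]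
    simp [Polynomial.IsRoot, hg1, ht]
    linear_combination (-(d.eval 1)) * hv

theorem exists_bezout_nat {L n : ℕ} (hL : 0 < L) (hn : 0 < n) (h : Nat.Coprime L n) (ε : ℤ) :
    ∃ s m : ℕ, (L : ℤ) * s = m * n + ε := by
  have hb : (L : ℤ) * Nat.gcdA L n + n * Nat.gcdB L n = 1 := by
    rw [← Nat.gcd_eq_gcd_ab, h.gcd_eq_one, Nat.cast_one]
  set x := ε * Nat.gcdA L n
  set y := ε * Nat.gcdB L n
  have hxy : (L : ℤ) * x + n * y = ε := by
    linear_combination ε * hb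
  -- Adding `nT` to `x` and `LT` to `-y` keeps the relation and makes both nonnegative.
  set T : ℤ := |x| + |y|
  have hL' : (1 : ℤ) ≤ L := by exact_mod_cast hL
  have hn' : (1 : ℤ) ≤ n := by exact_mod_cast hn
  have hT : 0 ≤ T := by positivity
  have h1 : 0 ≤ x + n * T := by nlinarith [neg_abs_le x, abs_nonneg y]
  have h2 : 0 ≤ -y + L * T := by nlinarith [le_abs_self y, abs_nonneg x]
  refine ⟨(x + n * T).toNat, (-y + L * T).toNat, ?_⟩
  rw [Int.toNat_of_nonneg h1, Int.toNat_of_nonneg h2]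
  linear_combination hxy

/-- Two power series with constant coefficient `1` and congruent `n`-th powers are congruent. -/
theorem X_pow_dvd_sub_of_pow {f g : PowerSeries ℂ} {n M : ℕ} (hn : 0 < n)
    (hf : PowerSeries.constantCoeff f = 1) (hg : PowerSeries.constantCoeff g = 1)
    (h : PowerSeries.X ^ M ∣ f ^ n - g ^ n) : PowerSeries.X ^ M ∣ f - g := by
  rw [← Commute.geom_sum₂_mul (Commute.all f g)] at h
  have hu : IsUnit (∑ i ∈ Finset.range n, f ^ i * g ^ (n - 1 - i)) := by
    rw [PowerSeries.isUnit_iff_constantCoeff]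
    simp [hf, hg, hn.ne']
  exact (hu.dvd_mul_left).1 h

/-- The family `q^{-cε/n}` is realizable on roots of unity `ξ` for which `n` is prime to the
order of `ξ^c`. -/
theorem realizable_root {c n : ℕ} (hc : 0 < c) (hn : 0 < n) (hu : IsUnit (n : R)) (ε : ℤ)
    {S : Set ℕ} (hS : ∀ r ∈ S, c ∣ r ∧ Nat.Coprime (r / c) n) (ω : ℂ → ℂ)
    (hω : ∀ ξ : ℂ, 0 < orderOf ξ → orderOf ξ ∈ S → ∀ m : ℕ,
      (orderOf ξ : ℤ) ∣ c * (m * n + ε) → ω ξ = ξ ^ (c * m)) :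
    Realizable R S fun ξ => PowerSeries.C (ω ξ) * pexp (-(c * ε / n)) := by
  classical
  intro M K
  set T := (Finset.range (K + 1)).filter fun r => 0 < r ∧ r ∈ S with hT
  set L := ∏ r ∈ T, r / c with hLdef
  have hL : 0 < L := by
    apply Finset.prod_pos
    intro r hr
    have hr' := (Finset.mem_filter.1 hr).2
    exact Nat.div_pos (Nat.le_of_dvd hr'.1 (hS r hr'.2).1) hc
  have hLn : Nat.Coprime L n :=
    Nat.Coprime.prod_left fun r hr => (hS r (Finset.mem_filter.1 hr).2.2).2
  -- Since `ξ^{cL} = 1` for every order in `T`, `q^{cL}` is close to `1` and `g(q^{cL})`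
  -- approximates `q^{-cLs/n}`. By `Ls = mn + ε`, the factor `q^{cm}` corrects this to `q^{-cε/n}`.
  obtain ⟨s, m, hsm⟩ := exists_bezout_nat hL hn hLn ε
  obtain ⟨g, hg1, d, hd⟩ := exists_approx_root hu s M
  refine ⟨X ^ (c * m) * g.comp (X ^ (c * L)), fun ξ h0 hK hξS => ?_⟩
  have hmem : orderOf ξ ∈ T := Finset.mem_filter.2 ⟨Finset.mem_range.2 (by omega), h0, hξS⟩
  have hdvd : orderOf ξ ∣ c * L := by
    have h1 : orderOf ξ / c ∣ L := Finset.dvd_prod_of_mem (fun r => r / c) hmem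
    calc orderOf ξ = c * (orderOf ξ / c) := (Nat.mul_div_cancel' (hS _ hξS).1).symm
      _ ∣ c * L := Nat.mul_dvd_mul_left c h1
  have hωm : ω ξ = ξ ^ (c * m) := by
    apply hω ξ h0 hξS m
    rw [← hsm, ← mul_assoc]
    exact Dvd.dvd.mul_right (by exact_mod_cast hdvd) _
  have hone : ξ ^ (c * L) = 1 := orderOf_dvd_iff_pow_eq_one.1 hdvd
  have hn0 : (n : ℂ) ≠ 0 := Nat.cast_ne_zero.2 hn.ne'
  set E := pexp (c * L : ℕ) with hE
  have hEv : localVar ξ ^ (c * L) = E := by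
    rw [localVar_pow, hone, map_one, one_mul]
  have hcomp : ∀ f : R[X], localExp ξ (f.comp (X ^ (c * L)))
      = eval₂ ((PowerSeries.C).comp (algebraMap R ℂ)) E f := by
    intro f
    have h2 := localExp_X (R := R) ξ
    simp only [localExp, coe_eval₂RingHom] at h2 ⊢
    rw [eval₂_comp, eval₂_pow, h2, hEv]
  set γ := localExp ξ (g.comp (X ^ (c * L))) with hγ
  have hX1 : PowerSeries.X ∣ E - 1 := by
    rw [PowerSeries.X_dvd_iff]
    simp [hE]
  have hγn : PowerSeries.X ^ M ∣ γ ^ n * E ^ s - 1 := by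
    have h3 := congrArg (eval₂ ((PowerSeries.C).comp (algebraMap R ℂ)) E) hd
    simp only [eval₂_mul, eval₂_sub, eval₂_pow, eval₂_X, eval₂_one] at h3
    rw [← hcomp g] at h3
    rw [h3]
    exact Dvd.dvd.mul_right ((pow_dvd_pow _ (Nat.le_succ M)).trans (pow_dvd_pow_of_dvd hX1 _)) _
  have hγ0 : PowerSeries.constantCoeff γ = 1 := by
    rw [hγ, constantCoeff_localExp]
    simp only [aeval_comp, map_pow, aeval_X, hone]
    have h4 := Polynomial.aeval_algebraMap_apply_eq_algebraMap_eval (A := ℂ) (1 : R) g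
    rwa [hg1, map_one] at h4
  set δ := pexp (-(c * L * s / n)) with hδ
  have hδn : δ ^ n * E ^ s = 1 := by
    rw [hδ, hE, pexp_pow, pexp_pow, ← pexp_add]
    rw [← pexp_zero]
    congr 1
    push_cast
    field_simp
    ring
  have hcong : PowerSeries.X ^ M ∣ γ - δ := by
    apply X_pow_dvd_sub_of_pow hn hγ0 (by simp [hδ])
    have hEu : IsUnit (E ^ s) := IsUnit.of_mul_eq_one_right _ hδn
    apply (hEu.dvd_mul_right).1
    rw [sub_mul, hδn]
    exact hγn
  have hfin : PowerSeries.C (ω ξ) * pexp (-(c * ε / n)) = localVar ξ ^ (c * m) * δ := by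
    rw [localVar_pow, hωm, mul_assoc, hδ, ← pexp_add]
    congr 2
    have hsm' : (L : ℂ) * s = m * n + ε := by exact_mod_cast hsm
    push_cast
    field_simp
    linear_combination (c : ℂ) * hsm'
  dsimp only
  rw [map_mul, map_pow, localExp_X, hfin, ← mul_sub]
  exact Dvd.dvd.mul_left hcong _

/-- A realizable family that is locally divisible by a product of cyclotomic polynomials may be
divided by it. -/
theorem Realizable.of_mul (hinj : Function.Injective (algebraMap R ℂ)) {D : R[X]}
    (hD : AssocMonic D) {K₀ e : ℕ}
    (hroot : ∀ ξ : ℂ, aeval ξ D = 0 → 0 < orderOf ξ ∧ orderOf ξ ≤ K₀)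
    (hmult : ∀ ξ : ℂ, localExp ξ D ∣ PowerSeries.X ^ e) {G : ℂ → PowerSeries ℂ}
    (h : Realizable R Set.univ fun ξ => localExp ξ D * G ξ) : Realizable R Set.univ G := by
  intro M K
  -- Dividing by `D` costs at most `e` orders of precision; orders up to `K₀` are included so that
  -- all roots of `D` are controlled.
  obtain ⟨P, hP⟩ := h (e + M) (max K K₀)
  have hdvd : D ∣ P := by
    apply dvd_of_localExp_dvd hinj hD
    intro ξ hξ
    obtain ⟨h0, h1⟩ := hroot ξ hξ
    refine ⟨ne_zero_of_orderOf_pos h0, ?_⟩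
    have h2 := (hmult ξ).trans ((pow_dvd_pow _ (Nat.le_add_right e M)).trans
      (hP ξ h0 (h1.trans (le_max_right _ _)) (Set.mem_univ _)))
    exact (dvd_sub_left (dvd_mul_right _ _)).1 h2
  obtain ⟨Q, rfl⟩ := hdvd
  refine ⟨Q, fun ξ h0 hK _ => ?_⟩
  have h3 := hP ξ h0 (hK.trans (le_max_left _ _)) (Set.mem_univ _)
  rw [map_mul, ← mul_sub, pow_add] at h3
  obtain ⟨z, hz⟩ := hmult ξ
  have h4 := Dvd.dvd.mul_left h3 z
  rw [show z * (localExp ξ D * (localExp ξ Q - G ξ))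
    = (localExp ξ D * z) * (localExp ξ Q - G ξ) by ring, ← hz] at h4
  exact (mul_dvd_mul_iff_left (pow_ne_zero _ PowerSeries.X_ne_zero)).1 h4

end Realizable

/-! ### Realizable families define elements of the completion -/

theorem algebraMap_ZInv_injective (b : ℤ) : Function.Injective (algebraMap (ZInv b) ℂ) := by
  intro x y h
  apply Subtype.ext
  have h' : ((x : ℚ) : ℂ) = ((y : ℚ) : ℂ) := h
  exact_mod_cast h'

/-- The polynomial matching the family to order `k` at orders at most `k` is determined modulo
`(q;q)_k`, whose zeros have order at most `k` and multiplicity at most `k`. Hence these polynomials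
are compatible. -/
theorem Realizable.exists_SRing {b : ℤ} {G : ℂ → PowerSeries ℂ}
    (hG : Realizable (ZInv b) Set.univ G) :
    ∃ Q : SRing b, ∀ (ξ : ℂ) (r : ℕ) (hξ : IsPrimitiveRoot ξ r) (hr : Odd r),
      evR b hξ hr (sToR b Q) = PowerSeries.constantCoeff (G ξ) := by
  choose P hP using fun k => hG k k
  have hloc : ∀ (k m : ℕ), k ≤ m → ∀ ξ : ℂ, 0 < orderOf ξ → orderOf ξ ≤ k →
      localExp ξ (qPoch (ZInv b) k) ∣ localExp ξ (P m) - G ξ := by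
    intro k m hkm ξ h0 hle
    have h1 : localExp ξ (qPoch (ZInv b) k) = ∏ j ∈ Finset.range k, (1 - localVar ξ ^ (j + 1)) := by
      simp [qPoch]
    rw [h1]
    exact (localVar_prod_dvd_X_pow ξ k).trans
      ((pow_dvd_pow _ hkm).trans (hP m ξ h0 (hle.trans hkm) (Set.mem_univ _)))
  have hcompat : ∀ (k m : ℕ), k ≤ m → qPoch (ZInv b) k ∣ P m - P k := by
    intro k m hkm
    apply dvd_of_localExp_dvd (algebraMap_ZInv_injective b) (assocMonic_prod k)
    intro ξ hξ
    obtain ⟨h0, hle⟩ := orderOf_of_aeval_prod hξ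
    refine ⟨ne_zero_of_orderOf_pos h0, ?_⟩
    have h2 := dvd_sub (hloc k m hkm ξ h0 hle) (hloc k k le_rfl ξ h0 hle)
    rw [sub_sub_sub_cancel_right] at h2
    rw [map_sub]
    exact h2
  have hmem : (fun k => Ideal.Quotient.mk (Ideal.span {qPoch (ZInv b) k}) (P k)) ∈ SRing b := by
    intro k m hkm
    rw [Ideal.Quotient.factor_mk, Ideal.Quotient.mk_eq_mk_iff_sub_mem,
      Ideal.mem_span_singleton]
    exact hcompat k m hkm
  refine ⟨⟨_, hmem⟩, fun ξ r hξ hr => ?_⟩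
  -- `evR` reads index `r`, and `sToR` fills it from index `2r`.
  have h1 : evR b hξ hr (sToR b ⟨_, hmem⟩) = aeval ξ (P (2 * r)) := rfl
  rw [h1, ← constantCoeff_localExp]
  have hord := hξ.eq_orderOf
  have hpos : 0 < orderOf ξ := hord ▸ hr.pos
  have h2 := hP (2 * r) ξ hpos (by omega) (Set.mem_univ _)
  have h3 : PowerSeries.X ∣ localExp ξ (P (2 * r)) - G ξ :=
    (dvd_pow_self _ (by have := hr.pos; omega)).trans h2
  rw [PowerSeries.X_dvd_iff, map_sub, sub_eq_zero] at h3
  exact h3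

/-! ### Values of rational functions -/

section Evaluation

/-- The rational function `f` is regular at `ξ`, with value `v`. -/
def HasEv (ξ : ℂ) (f : RatFunc ℚ) (v : ℂ) : Prop :=
  ∃ P Q : ℚ[X], aeval ξ Q ≠ 0 ∧ f * algebraMap ℚ[X] (RatFunc ℚ) Q = algebraMap ℚ[X] (RatFunc ℚ) P
    ∧ v * aeval ξ Q = aeval ξ P

variable {ξ : ℂ} {f g : RatFunc ℚ} {v w : ℂ}

/-- `ev` uses lowest terms, whose denominator divides that of any representation; so a nonvanishing
denominator in one representation suffices. -/
theorem HasEv.ev_eq (h : HasEv ξ f v) : ev ξ f = v := by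
  obtain ⟨P, Q, hQ, hf, hv⟩ := h
  have hQ0 : Q ≠ 0 := by
    rintro rfl
    simp at hQ
  have hinj := RatFunc.algebraMap_injective ℚ
  have hQ1 : algebraMap ℚ[X] (RatFunc ℚ) Q ≠ 0 := by
    rw [Ne, map_eq_zero_iff _ hinj]
    exact hQ0
  have hd : f.denom ∣ Q := (RatFunc.denom_dvd hQ0).2 ⟨P, eq_div_of_mul_eq hQ1 hf⟩
  obtain ⟨S, hS⟩ := hd
  have hd0 : aeval ξ f.denom ≠ 0 := by
    intro h0
    apply hQ
    rw [hS, map_mul, h0, zero_mul]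
  have hcross : f.num * Q = P * f.denom := by
    apply hinj
    rw [map_mul, map_mul, ← hf]
    have h1 := RatFunc.num_div_denom f
    have h2 : algebraMap ℚ[X] (RatFunc ℚ) f.denom ≠ 0 := by
      rw [Ne, map_eq_zero_iff _ hinj]
      exact f.denom_ne_zero
    rw [div_eq_iff h2] at h1
    rw [h1]
    ring
  have hev : ev ξ f = aeval ξ f.num / aeval ξ f.denom := rfl
  rw [hev, div_eq_iff hd0]
  have h3 := congrArg (aeval ξ) hcross
  rw [map_mul, map_mul, ← hv] at h3
  apply mul_right_cancel₀ hQ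
  rw [h3]
  ring

theorem HasEv.mul (hf : HasEv ξ f v) (hg : HasEv ξ g w) : HasEv ξ (f * g) (v * w) := by
  obtain ⟨P, Q, hQ, hfe, hv⟩ := hf
  obtain ⟨P', Q', hQ', hge, hw⟩ := hg
  refine ⟨P * P', Q * Q', by rw [map_mul]; exact mul_ne_zero hQ hQ', ?_, ?_⟩
  · rw [map_mul, map_mul, ← hfe, ← hge]; ring
  · rw [map_mul, map_mul, ← hv, ← hw]; ring

theorem HasEv.add (hf : HasEv ξ f v) (hg : HasEv ξ g w) : HasEv ξ (f + g) (v + w) := by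
  obtain ⟨P, Q, hQ, hfe, hv⟩ := hf
  obtain ⟨P', Q', hQ', hge, hw⟩ := hg
  refine ⟨P * Q' + P' * Q, Q * Q', by rw [map_mul]; exact mul_ne_zero hQ hQ', ?_, ?_⟩
  · rw [map_mul, map_add, map_mul, map_mul, ← hfe, ← hge]; ring
  · rw [map_mul, map_add, map_mul, map_mul, ← hv, ← hw]; ring

theorem HasEv.neg (hf : HasEv ξ f v) : HasEv ξ (-f) (-v) := by
  obtain ⟨P, Q, hQ, hfe, hv⟩ := hf
  exact ⟨-P, Q, hQ, by rw [map_neg, ← hfe, neg_mul], by rw [map_neg, ← hv, neg_mul]⟩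

theorem HasEv.sub (hf : HasEv ξ f v) (hg : HasEv ξ g w) : HasEv ξ (f - g) (v - w) := by
  rw [sub_eq_add_neg, sub_eq_add_neg]
  exact hf.add hg.neg

theorem HasEv.inv (hf : HasEv ξ f v) (h0 : v ≠ 0) : HasEv ξ f⁻¹ v⁻¹ := by
  obtain ⟨P, Q, hQ, hfe, hv⟩ := hf
  have hP : aeval ξ P ≠ 0 := hv ▸ mul_ne_zero h0 hQ
  have hf0 : f ≠ 0 := by
    rintro rfl
    rw [zero_mul] at hfe
    have : P = 0 := RatFunc.algebraMap_injective ℚ (by rw [← hfe, map_zero])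
    rw [this, map_zero] at hP
    exact hP rfl
  refine ⟨Q, P, hP, ?_, ?_⟩
  · rw [← hfe]
    field_simp
  · rw [← hv]
    field_simp

theorem HasEv.div (hf : HasEv ξ f v) (hg : HasEv ξ g w) (hw : w ≠ 0) :
    HasEv ξ (f / g) (v / w) := by
  rw [div_eq_mul_inv, div_eq_mul_inv]
  exact hf.mul (hg.inv hw)

theorem hasEv_one (ξ : ℂ) : HasEv ξ 1 1 := ⟨1, 1, by simp, by simp, by simp⟩

theorem hasEv_zero (ξ : ℂ) : HasEv ξ 0 0 := ⟨0, 1, by simp, by simp, by simp⟩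

theorem hasEv_q (ξ : ℂ) : HasEv ξ q ξ := ⟨X, 1, by simp, by simp [q], by simp⟩

theorem HasEv.pow (hf : HasEv ξ f v) (n : ℕ) : HasEv ξ (f ^ n) (v ^ n) := by
  induction n with
  | zero => simpa using hasEv_one ξ
  | succ n ih => rw [pow_succ, pow_succ]; exact ih.mul hf

theorem hasEv_q_zpow (hξ : ξ ≠ 0) (x : ℤ) : HasEv ξ (q ^ x) (ξ ^ x) := by
  obtain ⟨n, rfl | rfl⟩ := x.eq_nat_or_neg
  · simpa using (hasEv_q ξ).pow n
  · simpa using ((hasEv_q ξ).pow n).inv (pow_ne_zero n hξ)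

theorem HasEv.prod {ι : Type*} (s : Finset ι) {f : ι → RatFunc ℚ} {v : ι → ℂ}
    (h : ∀ i ∈ s, HasEv ξ (f i) (v i)) : HasEv ξ (∏ i ∈ s, f i) (∏ i ∈ s, v i) := by
  classical
  induction s using Finset.induction_on with
  | empty => simpa using hasEv_one ξ
  | insert i s hi ih =>
    rw [Finset.prod_insert hi, Finset.prod_insert hi]
    exact (h i (Finset.mem_insert_self i s)).mul
      (ih fun j hj => h j (Finset.mem_insert_of_mem hj))

theorem HasEv.sum {ι : Type*} (s : Finset ι) {f : ι → RatFunc ℚ} {v : ι → ℂ}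
    (h : ∀ i ∈ s, HasEv ξ (f i) (v i)) : HasEv ξ (∑ i ∈ s, f i) (∑ i ∈ s, v i) := by
  classical
  induction s using Finset.induction_on with
  | empty => simpa using hasEv_zero ξ
  | insert i s hi ih =>
    rw [Finset.sum_insert hi, Finset.sum_insert hi]
    exact (h i (Finset.mem_insert_self i s)).add
      (ih fun j hj => h j (Finset.mem_insert_of_mem hj))

theorem q_pow_ne_one {n : ℕ} (hn : n ≠ 0) : (q : RatFunc ℚ) ^ n ≠ 1 := by
  intro h
  have h1 : (X ^ n : ℚ[X]) = 1 := by
    apply RatFunc.algebraMap_injective ℚ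
    simpa [q] using h
  have := congrArg natDegree h1
  simp at this
  exact hn this

theorem hasEv_framing (hξ : ξ ≠ 0) (b : ℤ) (n : ℕ) :
    HasEv ξ (framing b n) (ξ ^ (b * (((n : ℤ) ^ 2 - 1) / 4))) :=
  hasEv_q_zpow hξ _

theorem hasEv_quantumInt (hξ : ξ ≠ 0) (n : ℕ) : HasEv ξ (quantumInt n)
    (ξ ^ (-(((n : ℤ) - 1) / 2)) * ∑ i ∈ Finset.range n, ξ ^ i) := by
  unfold quantumInt
  apply (hasEv_q_zpow hξ _).mul
  have h : (1 - (q : RatFunc ℚ) ^ n) / (1 - q) = ∑ i ∈ Finset.range n, q ^ i := by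
    rw [div_eq_iff, geom_sum_mul_neg]
    have := q_pow_ne_one one_ne_zero
    rw [pow_one] at this
    exact sub_ne_zero.2 this.symm
  rw [h]
  exact HasEv.sum _ fun i _ => (hasEv_q ξ).pow i

theorem hasEv_A (hξ : ξ ≠ 0) (n k : ℕ)
    (hd : (1 - ξ) * ∏ j ∈ Finset.range (k + 1), (1 - ξ ^ (k + 1) * ξ ^ j) ≠ 0) :
    HasEv ξ (A n k) ((∏ i ∈ Finset.range (k + 1),
      (ξ ^ (n : ℤ) + ξ ^ (-(n : ℤ)) - ξ ^ (i : ℤ) - ξ ^ (-(i : ℤ)))) /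
      ((1 - ξ) * ∏ j ∈ Finset.range (k + 1), (1 - ξ ^ (k + 1) * ξ ^ j))) := by
  unfold A
  refine HasEv.div (HasEv.prod _ fun i _ => ?_) (((hasEv_one ξ).sub (hasEv_q ξ)).mul
    (HasEv.prod _ fun j _ => ?_)) hd
  · exact (((hasEv_q_zpow hξ _).add (hasEv_q_zpow hξ _)).sub (hasEv_q_zpow hξ _)).sub
      (hasEv_q_zpow hξ _)
  · exact (hasEv_one ξ).sub (((hasEv_q ξ).pow _).mul ((hasEv_q ξ).pow _))

/-- `A(n,0) = q^{-1} [n]^2` for odd `n`. -/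
theorem A_zero_eq {n : ℕ} (hn : Odd n) : A n 0 = q ^ (-1 : ℤ) * (quantumInt n * quantumInt n) := by
  obtain ⟨m, rfl⟩ := hn
  have hq0 : (q : RatFunc ℚ) ≠ 0 := RatFunc.X_ne_zero
  have h1 : (1 : RatFunc ℚ) - q ≠ 0 := by
    have := q_pow_ne_one one_ne_zero
    rw [pow_one] at this
    exact sub_ne_zero.2 this.symm
  have h2 : (((2 * m + 1 : ℕ) : ℤ) - 1) / 2 = m := by push_cast; omega
  unfold A quantumInt
  rw [h2]
  simp only [zero_add, Finset.range_one, Finset.prod_singleton, pow_zero, mul_one, pow_one,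
    zpow_neg, zpow_natCast, zpow_one]
  field_simp
  ring

end Evaluation

/-! ### Quadratic Gauss sums -/

section GaussSum

variable {r : ℕ} [NeZero r]

/-- The quadratic exponential sum `∑_x χ(β x² + 4 a x)` over `ℤ/r`. -/
def quadSum (χ : AddChar (ZMod r) ℂ) (β a : ZMod r) : ℂ := ∑ x, χ (β * x ^ 2 + 4 * a * x)

/-- Translation by `2d` completes the square: `β(x+2d)² = βx² + 4ax + 4ad`. -/
theorem quadSum_of_mul_eq (χ : AddChar (ZMod r) ℂ) {β a d : ZMod r} (h : β * d = a) :
    quadSum χ β a = χ (-(4 * a * d)) * quadSum χ β 0 := by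
  unfold quadSum
  rw [Finset.mul_sum]
  apply Fintype.sum_equiv (Equiv.addRight (2 * d))
  intro x
  rw [← AddChar.map_add_eq_mul]
  congr 1
  simp only [Equiv.coe_addRight]
  rw [← h]
  ring

/-- Translation by `t` multiplies the sum by `χ(4at) ≠ 1`. -/
theorem quadSum_eq_zero (χ : AddChar (ZMod r) ℂ) {β a t : ZMod r} (h : β * t = 0)
    (ht : χ (4 * a * t) ≠ 1) : quadSum χ β a = 0 := by
  have h1 : quadSum χ β a = χ (4 * a * t) * quadSum χ β a := by
    conv_lhs => unfold quadSum
    unfold quadSum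
    rw [Finset.mul_sum]
    symm
    apply Fintype.sum_equiv (Equiv.addRight t)
    intro x
    rw [← AddChar.map_add_eq_mul]
    congr 1
    simp only [Equiv.coe_addRight]
    linear_combination (-(2 * x) - t) * h
  have h2 : (1 - χ (4 * a * t)) * quadSum χ β a = 0 := by
    rw [sub_mul, one_mul, ← h1, sub_self]
  exact (mul_eq_zero.1 h2).resolve_left (sub_ne_zero.2 ht.symm)

/-- Multiplied by the sum for `-β`, it gives `r` times the number of `d` with `βd = 0`, by
orthogonality of characters; `d = 0` always counts. -/
theorem quadSum_zero_ne_zero {χ : AddChar (ZMod r) ℂ} (hχ : χ.IsPrimitive) (h2 : IsUnit (2 : ZMod r))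
    (β : ZMod r) : quadSum χ β 0 ≠ 0 := by
  classical
  have key : quadSum χ β 0 * ∑ y, χ (-(β * y ^ 2))
      = (r : ℂ) * ((Finset.univ.filter fun d : ZMod r => β * d = 0).card : ℂ) := by
    unfold quadSum
    rw [Finset.mul_sum]
    have e1 : ∀ y : ZMod r, (∑ x, χ (β * x ^ 2 + 4 * 0 * x)) * χ (-(β * y ^ 2))
        = ∑ d, χ (β * d ^ 2) * χ (y * (2 * β * d)) := by
      intro y
      rw [Finset.sum_mul]
      symm
      apply Fintype.sum_equiv (Equiv.addRight y)
      intro d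
      rw [← AddChar.map_add_eq_mul, ← AddChar.map_add_eq_mul]
      congr 1
      simp only [Equiv.coe_addRight]
      ring
    rw [Finset.sum_congr rfl fun y _ => e1 y, Finset.sum_comm]
    have e2 : ∀ d : ZMod r, ∑ y, χ (β * d ^ 2) * χ (y * (2 * β * d))
        = if β * d = 0 then (r : ℂ) else 0 := by
      intro d
      rw [← Finset.mul_sum, AddChar.sum_mulShift _ hχ, ZMod.card]
      have h3 : 2 * β * d = 0 ↔ β * d = 0 := by
        rw [mul_assoc, h2.mul_right_eq_zero]
      simp only [h3]
      split_ifs with h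
      · rw [sq, ← mul_assoc, h, zero_mul, AddChar.map_zero_eq_one, one_mul]
      · simp
    rw [Finset.sum_congr rfl fun d _ => e2 d, ← Finset.sum_filter, Finset.sum_const,
      nsmul_eq_mul, mul_comm]
  intro h0
  rw [h0, zero_mul] at key
  have hr : (r : ℂ) ≠ 0 := Nat.cast_ne_zero.2 (NeZero.ne r)
  have hc : ((Finset.univ.filter fun d : ZMod r => β * d = 0).card : ℂ) ≠ 0 := by
    rw [Nat.cast_ne_zero, ← Nat.pos_iff_ne_zero, Finset.card_pos]
    exact ⟨0, by simp⟩
  exact mul_ne_zero hr hc key.symm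

/-- The odd integers in `(0, 2r)` represent each class modulo the odd number `r` once: an even
representative is shifted by `r`. -/
theorem sum_odd_eq_sum_zmod (hr : Odd r) (f : ZMod r → ℂ) :
    ∑ n ∈ (Finset.Ioo 0 (2 * r)).filter Odd, f (n : ZMod r) = ∑ x, f x := by
  have hval : ∀ x : ZMod r, x.val < r := ZMod.val_lt
  refine Finset.sum_nbij' (fun n : ℕ => (n : ZMod r))
    (fun x : ZMod r => if Odd x.val then x.val else x.val + r) ?_ ?_ ?_ ?_ ?_
  · intro n _
    exact Finset.mem_univ _
  · intro x _
    have := hval x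
    have hpos := hr.pos
    rw [Finset.mem_filter, Finset.mem_Ioo]
    split_ifs with h
    · exact ⟨⟨h.pos, by omega⟩, h⟩
    · exact ⟨⟨by omega, by omega⟩, (Nat.not_odd_iff_even.1 h).add_odd hr⟩
  · intro n hn
    rw [Finset.mem_filter, Finset.mem_Ioo] at hn
    obtain ⟨⟨h1, h2⟩, h3⟩ := hn
    rw [ZMod.val_natCast]
    rcases lt_or_ge n r with h | h
    · rw [Nat.mod_eq_of_lt h, if_pos h3]
    · have hmod : n % r = n - r := by
        rw [Nat.mod_eq_sub_mod h, Nat.mod_eq_of_lt (by omega)]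
      have hev : ¬ Odd (n - r) := by
        rw [Nat.not_odd_iff_even]
        exact Nat.Odd.sub_odd h3 hr
      rw [hmod, if_neg hev]
      omega
  · intro x _
    split_ifs
    · simp
    · simp
  · intro n _
    rfl

end GaussSum

/-! ### The Laplace transform of a monomial at a root of unity -/

section Phase

/-- `c = gcd(|b|, r)` for `ξ` of order `r`. -/
def phaseGcd (b : ℤ) (ξ : ℂ) : ℕ := Nat.gcd b.natAbs (orderOf ξ)

/-- The cofactor `|b| / c`. -/
def phaseCofactor (b : ℤ) (ξ : ℂ) : ℕ := b.natAbs / phaseGcd b ξ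

/-- The least `m` with `ξ^{c (m |b|/c + sign b)} = 1`. -/
def phaseExp (b : ℤ) (ξ : ℂ) : ℕ :=
  sInf {m : ℕ | (orderOf ξ : ℤ) ∣ phaseGcd b ξ * (m * phaseCofactor b ξ + b.sign)}

/-- The value at `ξ` of `q^{-c²/b}`. -/
def phaseRoot (b : ℤ) (ξ : ℂ) : ℂ := ξ ^ (phaseGcd b ξ * phaseExp b ξ)

/-- The value at `ξ` of the Laplace transform of `x^a`: that of `q^{-a²/b}` if `c ∣ a`, and `0`
otherwise. -/
def phase (b : ℤ) (ξ : ℂ) (a : ℤ) : ℂ :=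
  if (phaseGcd b ξ : ℤ) ∣ a then phaseRoot b ξ ^ ((a / phaseGcd b ξ) ^ 2) else 0

variable {b : ℤ} {ξ : ℂ}

theorem phaseGcd_dvd_order (b : ℤ) (ξ : ℂ) : phaseGcd b ξ ∣ orderOf ξ := Nat.gcd_dvd_right _ _

theorem phaseGcd_pos (hb : b ≠ 0) (ξ : ℂ) : 0 < phaseGcd b ξ :=
  Nat.gcd_pos_of_pos_left _ (Int.natAbs_pos.2 hb)

theorem phaseCofactor_pos (hb : b ≠ 0) (ξ : ℂ) : 0 < phaseCofactor b ξ :=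
  Nat.div_pos (Nat.le_of_dvd (Int.natAbs_pos.2 hb) (Nat.gcd_dvd_left _ _)) (phaseGcd_pos hb ξ)

theorem phaseGcd_mul_phaseCofactor (b : ℤ) (ξ : ℂ) :
    phaseGcd b ξ * phaseCofactor b ξ = b.natAbs :=
  Nat.mul_div_cancel' (Nat.gcd_dvd_left _ _)

theorem eq_sign_mul (b : ℤ) (ξ : ℂ) :
    b = b.sign * (phaseGcd b ξ * phaseCofactor b ξ) := by
  rw [← Nat.cast_mul, phaseGcd_mul_phaseCofactor]
  exact (Int.sign_mul_natAbs b).symm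

theorem coprime_order_phaseCofactor (hb : b ≠ 0) (ξ : ℂ) :
    Nat.Coprime (orderOf ξ / phaseGcd b ξ) (phaseCofactor b ξ) :=
  (Nat.coprime_div_gcd_div_gcd (phaseGcd_pos hb ξ)).symm

/-- The set defining `phaseExp` is nonempty, because `r/c` and `|b|/c` are coprime; so its infimum
is attained. -/
theorem phaseExp_spec (hb : b ≠ 0) (hξ : 0 < orderOf ξ) :
    (orderOf ξ : ℤ) ∣ phaseGcd b ξ * (phaseExp b ξ * phaseCofactor b ξ + b.sign) := by
  apply Nat.sInf_mem (s := {m : ℕ | (orderOf ξ : ℤ) ∣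
    phaseGcd b ξ * (m * phaseCofactor b ξ + b.sign)})
  have hL : 0 < orderOf ξ / phaseGcd b ξ :=
    Nat.div_pos (Nat.le_of_dvd hξ (phaseGcd_dvd_order b ξ)) (phaseGcd_pos hb ξ)
  obtain ⟨s, m, h⟩ := exists_bezout_nat hL (phaseCofactor_pos hb ξ)
    (coprime_order_phaseCofactor hb ξ) b.sign
  refine ⟨m, s, ?_⟩
  rw [← h, ← mul_assoc, ← Nat.cast_mul, Nat.mul_div_cancel' (phaseGcd_dvd_order b ξ)]

/-- Solutions `m` agree modulo `r/c`, hence `ξ^{cm}` does not depend on the choice. -/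
theorem phaseRoot_eq (hb : b ≠ 0) (hξ : 0 < orderOf ξ) {m : ℕ}
    (hm : (orderOf ξ : ℤ) ∣ phaseGcd b ξ * (m * phaseCofactor b ξ + b.sign)) :
    phaseRoot b ξ = ξ ^ (phaseGcd b ξ * m) := by
  have h := dvd_sub (phaseExp_spec hb hξ) hm
  obtain ⟨r₁, hr₁⟩ := phaseGcd_dvd_order b ξ
  have hc : (phaseGcd b ξ : ℤ) ≠ 0 := by exact_mod_cast (phaseGcd_pos hb ξ).ne'
  have hcop : IsCoprime (r₁ : ℤ) (phaseCofactor b ξ : ℤ) := by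
    have := coprime_order_phaseCofactor hb ξ
    rw [hr₁, Nat.mul_div_cancel_left _ (phaseGcd_pos hb ξ)] at this
    exact Nat.isCoprime_iff_coprime.2 this
  rw [← mul_sub, show ((phaseExp b ξ : ℤ) * phaseCofactor b ξ + b.sign)
    - (m * phaseCofactor b ξ + b.sign) = ((phaseExp b ξ : ℤ) - m) * phaseCofactor b ξ by ring,
    hr₁, Nat.cast_mul, mul_dvd_mul_iff_left hc] at h
  have h' := hcop.dvd_of_dvd_mul_right h
  have h1 : ξ ^ ((phaseGcd b ξ : ℤ) * ((phaseExp b ξ : ℤ) - m)) = 1 := by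
    rw [(IsPrimitiveRoot.orderOf ξ).zpow_eq_one_iff_dvd, hr₁, Nat.cast_mul]
    exact mul_dvd_mul_left _ h'
  unfold phaseRoot
  rw [← zpow_natCast, ← zpow_natCast, ← one_mul (ξ ^ ((phaseGcd b ξ * m : ℕ) : ℤ)), ← h1,
    ← zpow_add₀ (ne_zero_of_orderOf_pos hξ)]
  congr 1
  push_cast
  ring

theorem phaseRoot_zpow_eq_one {x : ℤ}
    (hx : (orderOf ξ : ℤ) ∣ phaseGcd b ξ * x) : phaseRoot b ξ ^ x = 1 := by
  unfold phaseRoot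
  rw [← zpow_natCast, ← zpow_mul]
  rw [← (IsPrimitiveRoot.orderOf ξ).zpow_eq_one_iff_dvd] at hx
  rw [show ((phaseGcd b ξ * phaseExp b ξ : ℕ) : ℤ) * x = (phaseGcd b ξ * x) * phaseExp b ξ by
    push_cast; ring, zpow_mul, hx, one_zpow]

theorem phaseRoot_ne_zero (hξ : 0 < orderOf ξ) : phaseRoot b ξ ≠ 0 :=
  pow_ne_zero _ (ne_zero_of_orderOf_pos hξ)

theorem phase_add_order (hb : b ≠ 0) (hξ : 0 < orderOf ξ) (a : ℤ) :
    phase b ξ (a + orderOf ξ) = phase b ξ a := by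
  obtain ⟨r₁, hr₁⟩ := phaseGcd_dvd_order b ξ
  have hc : (phaseGcd b ξ : ℤ) ≠ 0 := by exact_mod_cast (phaseGcd_pos hb ξ).ne'
  have hcr : (phaseGcd b ξ : ℤ) ∣ orderOf ξ := by exact_mod_cast phaseGcd_dvd_order b ξ
  unfold phase
  simp only [Int.dvd_add_left hcr]
  split_ifs with h
  · have h1 : (a + orderOf ξ) / (phaseGcd b ξ : ℤ) = a / phaseGcd b ξ + r₁ := by
      nth_rewrite 1 [hr₁]
      rw [Nat.cast_mul, Int.add_mul_ediv_left _ _ hc]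
    rw [h1, show (a / phaseGcd b ξ + r₁ : ℤ) ^ 2
      = (a / phaseGcd b ξ) ^ 2 + r₁ * (2 * (a / phaseGcd b ξ) + r₁) by ring,
      zpow_add₀ (phaseRoot_ne_zero hξ)]
    rw [phaseRoot_zpow_eq_one (x := r₁ * _), mul_one]
    rw [← mul_assoc, hr₁, Nat.cast_mul]
    exact dvd_mul_right _ _
  · rfl

theorem phase_neg (b : ℤ) (ξ : ℂ) (a : ℤ) : phase b ξ (-a) = phase b ξ a := by
  unfold phase
  simp only [Int.dvd_neg]
  split_ifs with h
  · rw [Int.neg_ediv_of_dvd h, neg_sq]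
  · rfl

@[simp] theorem phase_zero (b : ℤ) (ξ : ℂ) : phase b ξ 0 = 1 := by
  simp [phase]

/-- The local expansion of `q^{-c²/b}`. -/
def phaseSeries (b : ℤ) (ξ : ℂ) : PowerSeries ℂ :=
  PowerSeries.C (phaseRoot b ξ) * pexp (-(phaseGcd b ξ * b.sign / phaseCofactor b ξ))

theorem phase_mul_pexp (hb : b ≠ 0) (ξ : ℂ) (a : ℤ) :
    PowerSeries.C (phase b ξ a) * pexp (-((a : ℂ) ^ 2 / b))
      = if (phaseGcd b ξ : ℤ) ∣ a then phaseSeries b ξ ^ ((a / phaseGcd b ξ).natAbs ^ 2) else 0 := by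
  unfold phase
  split_ifs with h
  · obtain ⟨x, rfl⟩ := h
    have hc : (phaseGcd b ξ : ℤ) ≠ 0 := by exact_mod_cast (phaseGcd_pos hb ξ).ne'
    have hcc : (phaseGcd b ξ : ℂ) ≠ 0 := by exact_mod_cast (phaseGcd_pos hb ξ).ne'
    have hnc : (phaseCofactor b ξ : ℂ) ≠ 0 := by exact_mod_cast (phaseCofactor_pos hb ξ).ne'
    have hx : ((x.natAbs ^ 2 : ℕ) : ℤ) = x ^ 2 := by
      rw [Nat.cast_pow]
      exact Int.natAbs_sq x
    have hx' : ((x.natAbs ^ 2 : ℕ) : ℂ) = (x : ℂ) ^ 2 := by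
      rw [← Int.cast_natCast, hx, Int.cast_pow]
    rw [Int.mul_ediv_cancel_left _ hc, phaseSeries, mul_pow, ← map_pow, pexp_pow,
      ← zpow_natCast (phaseRoot b ξ), hx, hx']
    congr 2
    have hs : (b.sign : ℂ) * b.sign = 1 := by
      rcases lt_or_gt_of_ne hb with h | h
      · simp [Int.sign_eq_neg_one_of_neg h]
      · simp [Int.sign_eq_one_of_pos h]
    have hs0 : (b.sign : ℂ) ≠ 0 := left_ne_zero_of_mul_eq_one hs
    have hbe : (b : ℂ) = b.sign * (phaseGcd b ξ * phaseCofactor b ξ) := by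
      exact_mod_cast congrArg (Int.cast : ℤ → ℂ) (eq_sign_mul b ξ)
    rw [hbe]
    push_cast
    field_simp
    linear_combination (x : ℂ) ^ 2 * hs
  · simp

theorem zmodChar_intCast {r : ℕ} [NeZero r] {η : ℂ} (hη : η ^ r = 1) (x : ℤ) :
    AddChar.zmodChar r hη (x : ZMod r) = η ^ x := by
  have h1 : AddChar.zmodChar r hη (x : ZMod r) = (AddChar.zmodChar r hη (1 : ZMod r)) ^ x := by
    rw [← AddChar.map_zsmul_eq_zpow]
    simp
  have h2 : AddChar.zmodChar r hη (1 : ZMod r) = η := by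
    have := AddChar.zmodChar_apply' hη 1
    simpa using this
  rw [h1, h2]

/-- Completing the square. -/
theorem quadSum_eq_phase (hb : b ≠ 0) {r : ℕ} [NeZero r] (hξ : IsPrimitiveRoot ξ r) {η : ℂ}
    (hη : η ^ r = 1) (hη4 : η ^ 4 = ξ) (a : ℤ) :
    quadSum (AddChar.zmodChar r hη) (b : ZMod r) (a : ZMod r)
      = quadSum (AddChar.zmodChar r hη) (b : ZMod r) 0 * phase b ξ a := by
  have hord : orderOf ξ = r := hξ.eq_orderOf.symm
  have hpos : 0 < orderOf ξ := hord ▸ NeZero.pos r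
  have hchar4 : ∀ x : ℤ, AddChar.zmodChar r hη ((4 * x : ℤ) : ZMod r) = ξ ^ x := by
    intro x
    rw [zmodChar_intCast, zpow_mul, ← hη4]
    norm_cast
  by_cases h : (phaseGcd b ξ : ℤ) ∣ a
  · have hph : phase b ξ a = phaseRoot b ξ ^ ((a / phaseGcd b ξ) ^ 2) := if_pos h
    rw [hph]
    obtain ⟨x, rfl⟩ := h
    have hc : (phaseGcd b ξ : ℤ) ≠ 0 := by exact_mod_cast (phaseGcd_pos hb ξ).ne'
    rw [Int.mul_ediv_cancel_left _ hc]
    have hd : (b : ZMod r) * ((-(phaseExp b ξ * x) : ℤ) : ZMod r)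
        = ((phaseGcd b ξ * x : ℤ) : ZMod r) := by
      rw [← Int.cast_mul, ZMod.intCast_eq_intCast_iff_dvd_sub]
      have h1 := phaseExp_spec hb hpos
      rw [hord] at h1
      have hs : b.sign * b.sign = 1 := by
        rcases lt_or_gt_of_ne hb with h | h
        · simp [Int.sign_eq_neg_one_of_neg h]
        · simp [Int.sign_eq_one_of_pos h]
      refine h1.trans ⟨b.sign * x, ?_⟩
      nth_rewrite 2 [eq_sign_mul b ξ]
      linear_combination (-(phaseGcd b ξ : ℤ) * x) * hs
    rw [quadSum_of_mul_eq _ hd, mul_comm]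
    congr 1
    have h2 : -(4 * ((phaseGcd b ξ * x : ℤ) : ZMod r) * ((-(phaseExp b ξ * x) : ℤ) : ZMod r))
        = ((4 * (phaseGcd b ξ * phaseExp b ξ * x ^ 2) : ℤ) : ZMod r) := by
      push_cast
      ring
    rw [h2, hchar4, phaseRoot, ← zpow_natCast, ← zpow_mul]
    push_cast
    rfl
  · have hph : phase b ξ a = 0 := if_neg h
    rw [hph, mul_zero]
    obtain ⟨r₁, hr₁⟩ := phaseGcd_dvd_order b ξ
    rw [hord] at hr₁
    apply quadSum_eq_zero (t := ((r₁ : ℤ) : ZMod r))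
    · rw [← Int.cast_mul, ZMod.intCast_zmod_eq_zero_iff_dvd]
      refine ⟨b.sign * phaseCofactor b ξ, ?_⟩
      have h5 : (r : ℤ) = phaseGcd b ξ * r₁ := by exact_mod_cast hr₁
      nth_rewrite 1 [eq_sign_mul b ξ]
      rw [h5]
      ring
    · have h3 : 4 * (a : ZMod r) * ((r₁ : ℤ) : ZMod r) = ((4 * (a * r₁) : ℤ) : ZMod r) := by
        push_cast
        ring
      rw [h3, hchar4, Ne, hξ.zpow_eq_one_iff_dvd, hr₁, Nat.cast_mul]
      intro hdvd
      have hr0 : (r₁ : ℤ) ≠ 0 := by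
        intro h0
        rw [Int.natCast_eq_zero] at h0
        rw [h0, mul_zero] at hr₁
        exact NeZero.ne r hr₁
      exact h ((mul_dvd_mul_iff_right hr0).1 hdvd)

/-- If `c ≠ 1` the value is `0`. If `c = 1`, the value `1` would make `r` divide `phaseExp`, hence
also `sign b`. -/
theorem phase_one_ne_one (hb : b ≠ 0) {r : ℕ} (hξ : IsPrimitiveRoot ξ r) (hr : 1 < r) :
    phase b ξ 1 ≠ 1 := by
  have hord : orderOf ξ = r := hξ.eq_orderOf.symm
  have hpos : 0 < orderOf ξ := by omega
  by_cases h : (phaseGcd b ξ : ℤ) ∣ 1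
  · have hc : phaseGcd b ξ = 1 := by
      have := Int.natCast_dvd_natCast.1 (by simpa using h : (phaseGcd b ξ : ℤ) ∣ ((1 : ℕ) : ℤ))
      exact Nat.dvd_one.1 this
    have hph : phase b ξ 1 = ξ ^ phaseExp b ξ := by
      rw [phase, if_pos h, phaseRoot, hc]
      simp
    rw [hph, Ne, hξ.pow_eq_one_iff_dvd]
    intro hdvd
    have h1 := phaseExp_spec hb hpos
    rw [hord, hc, Nat.cast_one, one_mul] at h1
    have h2 : (r : ℤ) ∣ phaseExp b ξ * phaseCofactor b ξ :=
      Dvd.dvd.mul_right (by exact_mod_cast hdvd) _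
    have h3 : (r : ℤ) ∣ b.sign := (Int.dvd_add_right h2).1 h1
    have h4 := Int.natAbs_dvd_natAbs.2 h3
    rw [Int.natAbs_natCast, Int.natAbs_sign_of_ne_zero hb] at h4
    have := Nat.dvd_one.1 h4
    omega
  · rw [phase, if_neg h]
    exact zero_ne_one

end Phase

/-! ### Evaluation of the sums over odd colors -/

section OddSums

/-- Each factor is `x⁻¹(1 - xq^i)(1 - xq^{-i})`. For `i = 0` the factor `1 - x` occurs twice, which
explains the one outside the symmetric product. -/
theorem prod_range_eq_symm_prod {F : Type*} [Field F] {q x : F} (hq : q ≠ 0) (hx : x ≠ 0) (k : ℕ) :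
    ∏ i ∈ Finset.range (k + 1), (x + x⁻¹ - q ^ (i : ℤ) - q ^ (-(i : ℤ)))
      = (1 - x) * (x ^ (-1 - (k : ℤ)) *
        ∏ l ∈ Finset.range (2 * k + 1), (1 - x * q ^ ((l : ℤ) - k))) := by
  induction k with
  | zero =>
    simp
    field_simp
    ring
  | succ k ih =>
    rw [Finset.prod_range_succ, ih, show 2 * (k + 1) + 1 = (2 * k + 1 + 1) + 1 by ring,
      Finset.prod_range_succ _ (2 * k + 1 + 1), Finset.prod_range_succ' _ (2 * k + 1)]
    have e1 : ∏ l ∈ Finset.range (2 * k + 1), (1 - x * q ^ (((l + 1 : ℕ) : ℤ) - ((k + 1 : ℕ) : ℤ)))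
        = ∏ l ∈ Finset.range (2 * k + 1), (1 - x * q ^ ((l : ℤ) - k)) := by
      apply Finset.prod_congr rfl
      intro l _
      congr 3
      push_cast
      ring
    have e2 : x ^ (-1 - ((k + 1 : ℕ) : ℤ)) = x ^ (-1 - (k : ℤ)) * x⁻¹ := by
      rw [← zpow_neg_one x, ← zpow_add₀ hx]
      congr 1
      push_cast
      ring
    have e3 : q ^ (((2 * k + 1 + 1 : ℕ) : ℤ) - ((k + 1 : ℕ) : ℤ)) = q ^ ((k + 1 : ℕ) : ℤ) := by
      congr 1
      push_cast
      ring
    have e4 : q ^ (((0 : ℕ) : ℤ) - ((k + 1 : ℕ) : ℤ)) = q ^ (-((k + 1 : ℕ) : ℤ)) := by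
      rw [Nat.cast_zero, zero_sub]
    have e5 : q ^ ((k + 1 : ℕ) : ℤ) * q ^ (-((k + 1 : ℕ) : ℤ)) = 1 := by
      rw [← zpow_add₀ hq]
      simp
    rw [e1, e2, e3, e4]
    set u := q ^ ((k + 1 : ℕ) : ℤ)
    set w := q ^ (-((k + 1 : ℕ) : ℤ))
    have e6 : x + x⁻¹ - u - w = x⁻¹ * ((1 - x * w) * (1 - x * u)) := by
      field_simp
      linear_combination (-x ^ 2) * e5
    rw [e6]
    ring

theorem symm_prod_eq_sum {F : Type*} [Field F] {q x : F} (hq : q ≠ 0) (hx : x ≠ 0) (k : ℕ)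
    (hk : qFac q (2 * k + 1) ≠ 0) :
    ∏ i ∈ Finset.range (k + 1), (x + x⁻¹ - q ^ (i : ℤ) - q ^ (-(i : ℤ)))
      = (-1) ^ (k + 1) * (q ^ ((k + 1).choose 2))⁻¹ * qFac q (2 * k + 1)
        * ∑ a ∈ Finset.range (k + 1), (-1) ^ a * q ^ ((a + 1).choose 2)
          / (qFac q (k - a) * qFac q (k + 1 + a))
          * (x ^ (a : ℤ) + x ^ (-(a : ℤ)) - x ^ ((a : ℤ) + 1) - x ^ (-1 - (a : ℤ))) := by
  have h := sum_folded_eq_prod hq hx k hk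
  have hs : ((-1 : F) ^ (k + 1)) * (-1) ^ (k + 1) = 1 := by
    rw [← mul_pow]
    simp
  have hqk : q ^ ((k + 1).choose 2) ≠ 0 := pow_ne_zero _ hq
  have h1 : x ^ (-1 - (k : ℤ)) * ∏ l ∈ Finset.range (2 * k + 1), (1 - x * q ^ ((l : ℤ) - k))
      = (-1) ^ (k + 1) * (q ^ ((k + 1).choose 2))⁻¹ * qFac q (2 * k + 1)
        * ∑ a ∈ Finset.range (k + 1), (-1) ^ a * q ^ ((a + 1).choose 2)
        * (x ^ (a : ℤ) - x ^ (-1 - (a : ℤ))) / (qFac q (k - a) * qFac q (k + 1 + a)) := by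
    rw [h]
    field_simp
    rw [← pow_mul, mul_comm (k + 1) 2, pow_mul]
    simp
  rw [prod_range_eq_symm_prod hq hx, h1, mul_left_comm, Finset.mul_sum]
  congr 1
  apply Finset.sum_congr rfl
  intro a _
  have e1 : x ^ ((a : ℤ) + 1) = x * x ^ (a : ℤ) := by
    rw [add_comm, zpow_one_add₀ hx]
  have e2 : x ^ (-(a : ℤ)) = x * x ^ (-1 - (a : ℤ)) := by
    rw [← zpow_one_add₀ hx]
    congr 1
    ring
  rw [e1, e2]
  ring

variable {b : ℤ} {ξ : ℂ} {r : ℕ}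

theorem exists_fourth_root (hξ : IsPrimitiveRoot ξ r) (hr : Odd r) :
    ∃ η : ℂ, η ^ r = 1 ∧ η ^ 4 = ξ ∧ IsPrimitiveRoot η r := by
  obtain ⟨t, rfl⟩ := hr
  -- `t + 1` is the inverse of `2` modulo `r = 2t + 1`.
  have h4 : (ξ ^ ((t + 1) ^ 2)) ^ 4 = ξ := by
    rw [← pow_mul, show (t + 1) ^ 2 * 4 = (2 * t + 1) * (2 * t + 3) + 1 by ring, pow_succ, pow_mul,
      hξ.pow_eq_one, one_pow, one_mul]
  have h1 : (ξ ^ ((t + 1) ^ 2)) ^ (2 * t + 1) = 1 := by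
    rw [← pow_mul, mul_comm, pow_mul, hξ.pow_eq_one, one_pow]
  refine ⟨_, h1, h4, IsPrimitiveRoot.iff_def _ _ |>.2 ⟨h1, fun l hl => ?_⟩⟩
  apply hξ.dvd_of_pow_eq_one
  rw [← h4, ← pow_mul, mul_comm, pow_mul, hl, one_pow]

/-- The sums of `q^{b(n²-1)/4} q^{na}` over odd colors are proportional to the Laplace transform. -/
theorem exists_sum_framing_eq (hb : b ≠ 0) (hξ : IsPrimitiveRoot ξ r) (hr : Odd r) :
    ∃ κ : ℂ, κ ≠ 0 ∧ ∀ a : ℤ, ∑ n ∈ (Finset.Ioo 0 (2 * r)).filter Odd,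
      ξ ^ (b * (((n : ℤ) ^ 2 - 1) / 4)) * (ξ ^ (n : ℤ)) ^ a = κ * phase b ξ a := by
  have : NeZero r := ⟨hr.pos.ne'⟩
  obtain ⟨η, hη, hη4, hprim⟩ := exists_fourth_root hξ hr
  have hη0 : η ≠ 0 := by
    rintro rfl
    rw [zero_pow (NeZero.ne r)] at hη
    exact zero_ne_one hη
  have h2u : IsUnit (2 : ZMod r) := by
    have := (ZMod.isUnit_iff_coprime 2 r).2 (Nat.coprime_two_left.2 hr)
    simpa using this
  -- With `ξ = η⁴` the framing becomes `η^{bn² - b}`, which accounts for `η^{-b}`.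
  refine ⟨η ^ (-b) * quadSum (AddChar.zmodChar r hη) (b : ZMod r) 0,
    mul_ne_zero (zpow_ne_zero _ hη0) (quadSum_zero_ne_zero
      (AddChar.zmodChar_primitive_of_primitive_root r hprim) h2u _), fun a => ?_⟩
  rw [mul_assoc, ← quadSum_eq_phase hb hξ hη hη4, quadSum, ← sum_odd_eq_sum_zmod hr, Finset.mul_sum]
  apply Finset.sum_congr rfl
  intro n hn
  obtain ⟨m, rfl⟩ := (Finset.mem_filter.1 hn).2
  have h3 : (((2 * m + 1 : ℕ) : ℤ) ^ 2 - 1) / 4 = m ^ 2 + m := by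
    push_cast
    rw [show (2 * (m : ℤ) + 1) ^ 2 - 1 = 4 * (m ^ 2 + m) by ring]
    exact Int.mul_ediv_cancel_left _ (by norm_num)
  have h4 : (b : ZMod r) * ((2 * m + 1 : ℕ) : ZMod r) ^ 2 + 4 * (a : ZMod r) * ((2 * m + 1 : ℕ) : ZMod r)
      = ((b * (2 * m + 1) ^ 2 + 4 * a * (2 * m + 1) : ℤ) : ZMod r) := by
    push_cast
    ring
  have h5 : ∀ x : ℤ, ξ ^ x = η ^ (4 * x) := by
    intro x
    rw [zpow_mul, ← hη4]
    norm_cast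
  rw [h3, h4, zmodChar_intCast, ← zpow_mul, h5, h5, ← zpow_add₀ hη0, ← zpow_add₀ hη0]
  congr 1
  push_cast
  ring

theorem FUnknot_one (b : ℤ) : FUnknot b 1 1 = 1 := by
  have h : (Finset.Ioo 0 (2 * 1)).filter Odd = {1} := by decide
  unfold FUnknot oddSum
  rw [h, Finset.sum_singleton]
  have h1 : (quantumInt 1 : RatFunc ℚ) = 1 := by
    have := q_pow_ne_one one_ne_zero
    rw [pow_one] at this
    have h2 : (1 : RatFunc ℚ) - q ≠ 0 := sub_ne_zero.2 this.symm
    simp [quantumInt, div_self h2]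
  have h2 : jonesUnknot b 1 = 1 := by
    simp [jonesUnknot, h1, framing]
  simp only [h1, h2, mul_one]
  exact (hasEv_one 1).ev_eq

theorem FUnknot_eq (hξ : IsPrimitiveRoot ξ r) (hr : 1 < r) {κ : ℂ}
    (hκ : ∀ a : ℤ, ∑ n ∈ (Finset.Ioo 0 (2 * r)).filter Odd,
      ξ ^ (b * (((n : ℤ) ^ 2 - 1) / 4)) * (ξ ^ (n : ℤ)) ^ a = κ * phase b ξ a) :
    FUnknot b ξ r = ξ / (1 - ξ) ^ 2 * (κ * (2 * (phase b ξ 1 - 1))) := by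
  have hξ0 : ξ ≠ 0 := hξ.ne_zero (by omega)
  have hξ1 : 1 - ξ ≠ 0 := sub_ne_zero.2 (hξ.ne_one hr).symm
  have e : κ * (2 * (phase b ξ 1 - 1))
      = κ * phase b ξ 1 + κ * phase b ξ (-1) - 2 * (κ * phase b ξ 0) := by
    rw [phase_neg, phase_zero]
    ring
  rw [e, ← hκ, ← hκ, ← hκ, Finset.mul_sum, ← Finset.sum_add_distrib, ← Finset.sum_sub_distrib,
    Finset.mul_sum]
  unfold FUnknot oddSum
  apply Finset.sum_congr rfl
  intro n hn
  have hv := (hasEv_quantumInt hξ0 n).mul ((hasEv_framing hξ0 b n).mul (hasEv_quantumInt hξ0 n))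
  simp only [jonesUnknot]
  rw [hv.ev_eq]
  obtain ⟨m, rfl⟩ := (Finset.mem_filter.1 hn).2
  have h2 : (((2 * m + 1 : ℕ) : ℤ) - 1) / 2 = m := by push_cast; omega
  have hgeom : ∑ i ∈ Finset.range (2 * m + 1), ξ ^ i = (1 - ξ ^ (2 * m + 1)) / (1 - ξ) := by
    rw [eq_div_iff hξ1, geom_sum_mul_neg]
  rw [h2, hgeom]
  simp only [zpow_neg, zpow_natCast, zpow_one, zpow_zero]
  field_simp
  ring

theorem FUnknot_ne_zero (hb : b ≠ 0) (hξ : IsPrimitiveRoot ξ r) (hr : Odd r) :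
    FUnknot b ξ r ≠ 0 := by
  rcases Nat.lt_or_ge 1 r with h | h
  · obtain ⟨κ, hκ0, hκ⟩ := exists_sum_framing_eq hb hξ hr
    rw [FUnknot_eq hξ h hκ]
    have hξ0 : ξ ≠ 0 := hξ.ne_zero (by omega)
    have hξ1 : 1 - ξ ≠ 0 := sub_ne_zero.2 (hξ.ne_one h).symm
    exact mul_ne_zero (div_ne_zero hξ0 (pow_ne_zero _ hξ1)) (mul_ne_zero hκ0
      (mul_ne_zero two_ne_zero (sub_ne_zero.2 (phase_one_ne_one hb hξ h))))
  -- At `ξ = 1` the formula in terms of `φ(1) - 1` would divide by `1 - ξ = 0`; the sum is then the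
  -- single term `n = 1`.
  · have hr1 : r = 1 := by
      have := hr.pos
      omega
    subst hr1
    have hξ1 : ξ = 1 := by simpa using hξ.pow_eq_one
    subst hξ1
    rw [FUnknot_one]
    exact one_ne_zero

theorem oddSum_A_zero (hξ : IsPrimitiveRoot ξ r) (hr : Odd r) :
    oddSum ξ r (fun n => framing b n * A n 0) = ξ⁻¹ * FUnknot b ξ r := by
  have hξ0 : ξ ≠ 0 := hξ.ne_zero hr.pos.ne'
  unfold FUnknot oddSum
  rw [Finset.mul_sum]
  apply Finset.sum_congr rfl
  intro n hn
  have hv := (hasEv_quantumInt hξ0 n).mul ((hasEv_framing hξ0 b n).mul (hasEv_quantumInt hξ0 n))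
  have hv' := (hasEv_q_zpow hξ0 (-1)).mul hv
  simp only [jonesUnknot]
  rw [A_zero_eq (Finset.mem_filter.1 hn).2, hv.ev_eq, ← zpow_neg_one, ← hv'.ev_eq]
  congr 1
  ring

theorem qFac_ne_zero_of_primitive (hξ : IsPrimitiveRoot ξ r) {n : ℕ} (h : n < r) :
    qFac ξ n ≠ 0 := by
  unfold qFac
  rw [Finset.prod_ne_zero_iff]
  intro j hj
  have := Finset.mem_range.1 hj
  rw [sub_ne_zero]
  exact (hξ.pow_ne_one_of_pos_of_lt (Nat.succ_ne_zero j) (by omega)).symm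

/-- The Laplace transform of the cyclotomic basis element, up to elementary factors. -/
def phaseSum (b : ℤ) (ξ : ℂ) (k : ℕ) : ℂ :=
  ∑ a ∈ Finset.range (k + 1), (-1) ^ a * ξ ^ ((a + 1).choose 2)
    / (qFac ξ (k - a) * qFac ξ (k + 1 + a)) * (phase b ξ a - phase b ξ (a + 1))

theorem oddSum_A_eq (hξ : IsPrimitiveRoot ξ r) {k : ℕ} (hk : 2 * k + 1 < r) {κ : ℂ}
    (hκ : ∀ a : ℤ, ∑ n ∈ (Finset.Ioo 0 (2 * r)).filter Odd,
      ξ ^ (b * (((n : ℤ) ^ 2 - 1) / 4)) * (ξ ^ (n : ℤ)) ^ a = κ * phase b ξ a) :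
    oddSum ξ r (fun n => framing b n * A n k)
      = (-1) ^ (k + 1) * (ξ ^ ((k + 1).choose 2))⁻¹ * qFac ξ k / (1 - ξ)
        * (κ * (2 * phaseSum b ξ k)) := by
  have hξ0 : ξ ≠ 0 := hξ.ne_zero (by omega)
  have hξ1 : 1 - ξ ≠ 0 := sub_ne_zero.2 (hξ.ne_one (by omega)).symm
  have hfac : qFac ξ (2 * k + 1) ≠ 0 := qFac_ne_zero_of_primitive hξ hk
  set T := ∏ j ∈ Finset.range (k + 1), (1 - ξ ^ (k + 1) * ξ ^ j) with hT
  have hsplit : qFac ξ (2 * k + 1) = qFac ξ k * T := by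
    rw [← qFac_mul_prod_Ico ξ (show k ≤ 2 * k + 1 by omega), Finset.prod_Ico_eq_prod_range,
      show 2 * k + 1 - k = k + 1 by omega, hT]
    congr 1
    apply Finset.prod_congr rfl
    intro j _
    ring
  have hT0 : T ≠ 0 := right_ne_zero_of_mul (hsplit ▸ hfac)
  have e : κ * (2 * phaseSum b ξ k) = ∑ a ∈ Finset.range (k + 1),
      (-1) ^ a * ξ ^ ((a + 1).choose 2) / (qFac ξ (k - a) * qFac ξ (k + 1 + a))
      * (κ * phase b ξ a + κ * phase b ξ (-a) - κ * phase b ξ (a + 1) - κ * phase b ξ (-1 - a)) := by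
    unfold phaseSum
    rw [← mul_assoc, Finset.mul_sum]
    apply Finset.sum_congr rfl
    intro a _
    rw [phase_neg, show (-1 - (a : ℤ)) = -(a + 1) by ring, phase_neg]
    ring
  have e2 : κ * (2 * phaseSum b ξ k) = ∑ n ∈ (Finset.Ioo 0 (2 * r)).filter Odd,
      ξ ^ (b * (((n : ℤ) ^ 2 - 1) / 4)) * ∑ a ∈ Finset.range (k + 1),
      (-1) ^ a * ξ ^ ((a + 1).choose 2) / (qFac ξ (k - a) * qFac ξ (k + 1 + a))
      * ((ξ ^ (n : ℤ)) ^ (a : ℤ) + (ξ ^ (n : ℤ)) ^ (-(a : ℤ)) - (ξ ^ (n : ℤ)) ^ ((a : ℤ) + 1)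
        - (ξ ^ (n : ℤ)) ^ (-1 - (a : ℤ))) := by
    rw [e]
    simp_rw [← hκ]
    simp_rw [Finset.mul_sum (s := Finset.range (k + 1))]
    rw [Finset.sum_comm]
    apply Finset.sum_congr rfl
    intro a _
    rw [← Finset.sum_add_distrib, ← Finset.sum_sub_distrib, ← Finset.sum_sub_distrib,
      Finset.mul_sum]
    apply Finset.sum_congr rfl
    intro n _
    ring
  rw [e2, Finset.mul_sum]
  unfold oddSum
  apply Finset.sum_congr rfl
  intro n _
  have hv := (hasEv_framing hξ0 b n).mul (hasEv_A hξ0 n k (mul_ne_zero hξ1 hT0))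
  rw [hv.ev_eq, ← hT]
  have hprod := symm_prod_eq_sum hξ0 (zpow_ne_zero (n : ℤ) hξ0) k hfac
  rw [zpow_neg ξ (n : ℤ), hprod, hsplit]
  field_simp

end OddSums

/-! ### The interpolating family -/

section Family

theorem isUnit_natCast_ZInv {b : ℤ} (hb : b ≠ 0) {n : ℕ} (hn : n ∣ b.natAbs) :
    IsUnit ((n : ℕ) : ZInv b) := by
  have hbu : IsUnit ((b : ℤ) : ZInv b) := by
    apply IsUnit.of_mul_eq_one ⟨(b : ℚ)⁻¹, Algebra.subset_adjoin rfl⟩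
    apply Subtype.ext
    have hb' : (b : ℚ) ≠ 0 := Int.cast_ne_zero.2 hb
    simp [hb']
  apply isUnit_of_dvd_unit _ hbu
  have h : (n : ℤ) ∣ b := Int.natCast_dvd.2 hn
  obtain ⟨x, hx⟩ := h
  exact ⟨(x : ZInv b), by rw [← Int.cast_natCast, ← Int.cast_mul, ← hx]⟩

theorem realizable_phaseSeries {b : ℤ} (hb : b ≠ 0) {c : ℕ} (hc : c ∣ b.natAbs) :
    Realizable (ZInv b) {r | Nat.gcd b.natAbs r = c} (phaseSeries b) := by
  have hpos := Int.natAbs_pos.2 hb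
  have hc0 : 0 < c := Nat.pos_of_dvd_of_pos hc hpos
  have hn0 : 0 < b.natAbs / c := Nat.div_pos (Nat.le_of_dvd hpos hc) hc0
  refine (realizable_root hc0 hn0 (isUnit_natCast_ZInv hb (Nat.div_dvd_of_dvd hc)) b.sign ?_
    (phaseRoot b) ?_).congr ?_
  · rintro r rfl
    exact ⟨Nat.gcd_dvd_right _ _, (Nat.coprime_div_gcd_div_gcd hc0).symm⟩
  · rintro ξ h0 rfl m hm
    exact phaseRoot_eq hb h0 hm
  · rintro ξ _ rfl
    rfl

/-- The local expansion of `q^{-1}`. -/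
def localInv (ξ : ℂ) : PowerSeries ℂ := PowerSeries.C ξ⁻¹ * pexp (-1)

theorem realizable_localInv (R : Type*) [CommRing R] [Algebra R ℂ] (S : Set ℕ) :
    Realizable R S localInv := by
  refine (realizable_root (c := 1) (n := 1) one_pos one_pos (by simp) 1 (S := S) ?_
    (fun ξ => ξ⁻¹) ?_).congr ?_
  · intro r _
    simp
  · intro ξ h0 _ m hm
    have h1 : ξ ^ (m + 1) = 1 := by
      rw [← orderOf_dvd_iff_pow_eq_one]
      have : (orderOf ξ : ℤ) ∣ ((m + 1 : ℕ) : ℤ) := by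
        simpa using hm
      exact_mod_cast this
    rw [one_mul]
    exact inv_eq_of_mul_eq_one_left (by rw [← pow_succ, h1])
  · intro ξ _ _
    simp [localInv]

/-- The local expansion of `(1-q) / (L(x) - 1)`, where `L(x)` is the Laplace transform of `x`. -/
def denomSeries (b : ℤ) (ξ : ℂ) : PowerSeries ℂ :=
  if phaseGcd b ξ = 1 then
    (if 0 < b then localVar ξ else -1) * ∑ i ∈ Finset.range b.natAbs, phaseSeries b ξ ^ i
  else localVar ξ - 1

theorem realizable_localVar (R : Type*) [CommRing R] [Algebra R ℂ] (S : Set ℕ) :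
    Realizable R S localVar :=
  (realizable_localExp S X).congr fun ξ _ _ => localExp_X ξ

theorem realizable_denomSeries {b : ℤ} (hb : b ≠ 0) {c : ℕ} (hc : c ∣ b.natAbs) :
    Realizable (ZInv b) {r | Nat.gcd b.natAbs r = c} (denomSeries b) := by
  by_cases h1 : c = 1
  · have hs := Realizable.sum (Finset.range b.natAbs)
      fun i _ => (realizable_phaseSeries hb hc).pow i
    have hsgn : Realizable (ZInv b) {r | Nat.gcd b.natAbs r = c}
        fun ξ => if 0 < b then localVar ξ else -1 := by
      split_ifs
      · exact realizable_localVar _ _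
      · exact (realizable_one _).neg
    refine (hsgn.mul hs).congr fun ξ _ hξ => ?_
    have h2 : phaseGcd b ξ = 1 := Eq.trans hξ h1
    rw [denomSeries, if_pos h2]
  · refine ((realizable_localVar _ _).sub (realizable_one _)).congr fun ξ _ hξ => ?_
    have h2 : phaseGcd b ξ ≠ 1 := fun h => h1 (Eq.trans (Eq.symm hξ) h)
    rw [denomSeries, if_neg h2]

theorem constantCoeff_phaseSeries (b : ℤ) (ξ : ℂ) :
    PowerSeries.constantCoeff (phaseSeries b ξ) = phaseRoot b ξ := by
  simp [phaseSeries]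

/-- For `c = 1`, `ω = φ(1)` satisfies `ω^{|b|} = ξ^{-sign b}`, so the geometric sum in `ω` inverts
`ω - 1` up to `1 - ξ` and a unit. For `c ≠ 1`, `φ(1) = 0`. -/
theorem denomSeries_mul {b : ℤ} (hb : b ≠ 0) {ξ : ℂ} (hξ : 0 < orderOf ξ) :
    PowerSeries.constantCoeff (denomSeries b ξ) * (phase b ξ 1 - 1) = 1 - ξ := by
  have hvar : PowerSeries.constantCoeff (localVar ξ) = ξ := by simp [localVar]
  by_cases h1 : phaseGcd b ξ = 1
  · have hph : phase b ξ 1 = phaseRoot b ξ := by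
      simp [phase, h1]
    have hn : phaseCofactor b ξ = b.natAbs := by
      simp [phaseCofactor, h1]
    have hpow : phaseRoot b ξ ^ b.natAbs * ξ ^ b.sign = 1 := by
      have h2 := phaseExp_spec hb hξ
      rw [← (IsPrimitiveRoot.orderOf ξ).zpow_eq_one_iff_dvd, h1, hn, Nat.cast_one, one_mul,
        zpow_add₀ (ne_zero_of_orderOf_pos hξ)] at h2
      rw [← h2, phaseRoot, h1, one_mul, ← pow_mul, ← Nat.cast_mul, zpow_natCast]
    rw [denomSeries, if_pos h1, hph, map_mul, map_sum, mul_assoc]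
    simp only [map_pow, constantCoeff_phaseSeries]
    rw [geom_sum_mul]
    rcases lt_or_gt_of_ne hb with h | h
    · rw [if_neg (by omega), Int.sign_eq_neg_one_of_neg h] at *
      rw [zpow_neg_one] at hpow
      have h3 : phaseRoot b ξ ^ b.natAbs = ξ := by
        field_simp [ne_zero_of_orderOf_pos hξ] at hpow
        exact hpow
      rw [h3]
      simp
    · rw [if_pos h, hvar]
      rw [Int.sign_eq_one_of_pos h, zpow_one] at hpow
      linear_combination hpow
  · have hph : phase b ξ 1 = 0 := by
      have : ¬ (phaseGcd b ξ : ℤ) ∣ 1 := by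
        intro h
        apply h1
        have h' : (phaseGcd b ξ : ℤ) ∣ ((1 : ℕ) : ℤ) := by simpa using h
        exact Nat.dvd_one.1 (Int.natCast_dvd_natCast.1 h')
      rw [phase, if_neg this]
    rw [denomSeries, if_neg h1, hph, map_sub, hvar, map_one]
    ring

/-- The local expansion of the Laplace transform of `x^a`. -/
def monomialSeries (b : ℤ) (ξ : ℂ) (a : ℤ) : PowerSeries ℂ :=
  PowerSeries.C (phase b ξ a) * pexp (-((a : ℂ) ^ 2 / b))

theorem constantCoeff_monomialSeries (b : ℤ) (ξ : ℂ) (a : ℤ) :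
    PowerSeries.constantCoeff (monomialSeries b ξ a) = phase b ξ a := by
  simp [monomialSeries]

theorem realizable_monomialSeries {b : ℤ} (hb : b ≠ 0) {c : ℕ} (hc : c ∣ b.natAbs) (a : ℤ) :
    Realizable (ZInv b) {r | Nat.gcd b.natAbs r = c} fun ξ => monomialSeries b ξ a := by
  by_cases h : (c : ℤ) ∣ a
  · refine ((realizable_phaseSeries hb hc).pow ((a / c).natAbs ^ 2)).congr ?_
    rintro ξ _ rfl
    rw [monomialSeries, phase_mul_pexp hb]
    exact (if_pos h).symm
  · refine (realizable_zero _).congr ?_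
    rintro ξ _ rfl
    rw [monomialSeries, phase_mul_pexp hb]
    exact (if_neg h).symm

/-- The local expansion of `laplaceDen q k` times the quotient of the two sums over colors. -/
def quotientNum (b : ℤ) (k : ℕ) (ξ : ℂ) : PowerSeries ℂ :=
  (-1) ^ (k + 1) * localInv ξ ^ ((k + 1).choose 2 + 1) * denomSeries b ξ
    * ∑ a ∈ Finset.range (k + 1), laplaceNum (localVar ξ) k a
      * (monomialSeries b ξ a - monomialSeries b ξ (a + 1))

theorem realizable_quotientNum_of_gcd {b : ℤ} (hb : b ≠ 0) {c : ℕ} (hc : c ∣ b.natAbs) (k : ℕ) :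
    Realizable (ZInv b) {r | Nat.gcd b.natAbs r = c} (quotientNum b k) := by
  have hlap : ∀ a, Realizable (ZInv b) {r | Nat.gcd b.natAbs r = c}
      fun ξ => laplaceNum (localVar ξ) k a := fun a =>
    (realizable_localExp _ (laplaceNum X k a)).congr fun ξ _ _ => by
      rw [map_laplaceNum, localExp_X]
  exact (((((realizable_one _).neg).pow (k + 1)).mul ((realizable_localInv _ _).pow _)).mul
    (realizable_denomSeries hb hc)).mul (Realizable.sum _ fun a _ => (hlap a).mul
      ((realizable_monomialSeries hb hc _).sub (realizable_monomialSeries hb hc _)))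

/-- The possible gcds are the powers `p^i` with `i ≤ l`. Starting from the stratum of gcd `1`, the
strata are attached one at a time; invertibility of `p` is needed only when `l > 0`. -/
theorem realizable_quotientNum {b : ℤ} {p l : ℕ} (hp : p.Prime) (hb : b.natAbs = p ^ l) (k : ℕ) :
    Realizable (ZInv b) Set.univ (quotientNum b k) := by
  have hb0 : b ≠ 0 := by
    rw [← Int.natAbs_ne_zero, hb]
    exact pow_ne_zero _ hp.ne_zero
  have key : ∀ j ≤ l, Realizable (ZInv b) {r | ¬ p ^ (j + 1) ∣ Nat.gcd b.natAbs r}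
      (quotientNum b k) := by
    intro j
    induction j with
    | zero =>
      intro _
      refine (realizable_quotientNum_of_gcd hb0 (one_dvd _) k).mono fun r _ hr => ?_
      obtain ⟨i, _, hi⟩ := (Nat.dvd_prime_pow hp).1
        (show Nat.gcd b.natAbs r ∣ p ^ l from hb ▸ Nat.gcd_dvd_left _ _)
      rcases i with _ | i
      · simpa using hi
      · exfalso
        apply hr
        rw [hi, zero_add, pow_one]
        exact dvd_pow_self p (Nat.succ_ne_zero i)
    | succ j ih =>
      intro hj
      have hu : IsUnit ((p : ℕ) : ZInv b) := by
        apply isUnit_natCast_ZInv hb0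
        rw [hb]
        exact dvd_pow_self p (by omega)
      refine Realizable.glue hp hu j ((ih (by omega)).mono ?_)
        ((realizable_quotientNum_of_gcd hb0 (c := p ^ (j + 1))
          (by rw [hb]; exact pow_dvd_pow p hj) k).mono ?_)
      · rintro r _ ⟨h1, _⟩ h
        exact h1 (h.trans (Nat.gcd_dvd_right _ _))
      · rintro r _ ⟨h1, h2⟩
        obtain ⟨i, _, hi⟩ := (Nat.dvd_prime_pow hp).1
          (show Nat.gcd b.natAbs r ∣ p ^ l from hb ▸ Nat.gcd_dvd_left _ _)
        have h3 : p ^ (j + 1) ∣ Nat.gcd b.natAbs r :=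
          Nat.dvd_gcd (by rw [hb]; exact pow_dvd_pow p hj) h1
        have h2' : ¬ p ^ (j + 1 + 1) ∣ Nat.gcd b.natAbs r := h2
        rw [hi, Nat.pow_dvd_pow_iff_le_right hp.one_lt] at h3 h2'
        change Nat.gcd b.natAbs r = p ^ (j + 1)
        rw [hi]
        congr 1
        omega
  refine (key l le_rfl).mono fun r _ _ h => ?_
  have h1 : p ^ (l + 1) ∣ p ^ l := h.trans (hb ▸ Nat.gcd_dvd_left _ _)
  rw [Nat.pow_dvd_pow_iff_le_right hp.one_lt] at h1
  omega

/-- `phase` is periodic and even, so `φ(a+1) = φ(-1-a)` and the sum is of the paired form for which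
divisibility was proved. -/
theorem laplaceDen_dvd_quotientNum {b : ℤ} (hb : b ≠ 0) (k : ℕ) {ξ : ℂ} (hξ : 0 < orderOf ξ) :
    laplaceDen (localVar ξ) k ∣ quotientNum b k ξ := by
  apply Dvd.dvd.mul_left
  have h := laplaceDen_dvd_sum_periodic hξ k hb (phase b ξ) (phase_add_order hb hξ)
  convert h using 4 with a _
  · rfl
  · have e : (-1 - (a : ℤ)) = -(a + 1) := by ring
    rw [monomialSeries, e, phase_neg]
    push_cast
    congr 3
    ring

theorem exists_quotient_family {b : ℤ} {p l : ℕ} (hp : p.Prime) (hb : b.natAbs = p ^ l) (k : ℕ) :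
    ∃ G : ℂ → PowerSeries ℂ, Realizable (ZInv b) Set.univ G ∧
      ∀ ξ, 0 < orderOf ξ → laplaceDen (localVar ξ) k * G ξ = quotientNum b k ξ := by
  have hb0 : b ≠ 0 := by
    rw [← Int.natAbs_ne_zero, hb]
    exact pow_ne_zero _ hp.ne_zero
  -- Division is done separately at each root of unity; `Realizable.of_mul` then shows that the
  -- quotients still form a realizable family.
  choose! G hG using fun ξ (hξ : 0 < orderOf ξ) => laplaceDen_dvd_quotientNum hb0 k hξ
  refine ⟨G, ?_, fun ξ hξ => (hG ξ hξ).symm⟩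
  have hexp : ∀ ξ : ℂ, localExp ξ (laplaceDen (X : (ZInv b)[X]) k) = laplaceDen (localVar ξ) k :=
    fun ξ => by rw [map_laplaceDen, localExp_X]
  apply Realizable.of_mul (algebraMap_ZInv_injective b) (D := laplaceDen X k) (K₀ := 2 * k + 1)
    (e := (2 * k + 1) * 2)
  · rw [laplaceDen, sq]
    exact (assocMonic_prod _).mul (assocMonic_prod _)
  · intro ξ h
    rw [laplaceDen, map_pow] at h
    exact orderOf_of_aeval_prod (pow_eq_zero_iff two_ne_zero |>.1 h)
  · intro ξ
    rw [hexp, laplaceDen, pow_mul]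
    exact pow_dvd_pow_of_dvd (localVar_prod_dvd_X_pow ξ _) 2
  · refine (realizable_quotientNum hp hb k).congr fun ξ hξ _ => ?_
    rw [hexp, hG ξ hξ]

/-- The bound `2k + 1 < r` makes `laplaceDen ξ k` nonzero, so it cancels from constant terms; the
Gauss sum `κ` cancels between numerator and denominator. -/
theorem quotient_eq_constantCoeff {b : ℤ} (hb : b ≠ 0) {ξ : ℂ} {r k : ℕ}
    (hξ : IsPrimitiveRoot ξ r) (hr : Odd r) (hk : 2 * k + 1 < r) {g : PowerSeries ℂ}
    (hg : laplaceDen (localVar ξ) k * g = quotientNum b k ξ) :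
    oddSum ξ r (fun n => framing b n * A n k) / FUnknot b ξ r = PowerSeries.constantCoeff g := by
  have hpos : 0 < orderOf ξ := by
    rw [← hξ.eq_orderOf]
    omega
  have hξ0 : ξ ≠ 0 := ne_zero_of_orderOf_pos hpos
  have hξ1 : 1 - ξ ≠ 0 := sub_ne_zero.2 (hξ.ne_one (by omega)).symm
  have hfac : qFac ξ (2 * k + 1) ≠ 0 := qFac_ne_zero_of_primitive hξ hk
  have hvar : PowerSeries.constantCoeff (localVar ξ) = ξ := by simp [localVar]
  have hden : laplaceDen ξ k ≠ 0 := pow_ne_zero 2 hfac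
  have hφ := sub_ne_zero.2 (phase_one_ne_one hb hξ (by omega))
  have h0 := congrArg PowerSeries.constantCoeff hg
  rw [map_mul, map_laplaceDen, hvar, quotientNum, map_mul, map_mul, map_mul, map_pow, map_pow,
    map_neg, map_one, map_sum] at h0
  have hsum : ∑ a ∈ Finset.range (k + 1), PowerSeries.constantCoeff
      (laplaceNum (localVar ξ) k a * (monomialSeries b ξ a - monomialSeries b ξ (a + 1)))
      = laplaceDen ξ k * (qFac ξ k * phaseSum b ξ k) := by
    unfold phaseSum
    rw [Finset.mul_sum, Finset.mul_sum]
    apply Finset.sum_congr rfl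
    intro a ha
    rw [map_mul, map_laplaceNum, hvar, map_sub, constantCoeff_monomialSeries,
      constantCoeff_monomialSeries,
      laplaceNum_eq hfac (Nat.lt_succ_iff.1 (Finset.mem_range.1 ha))]
    ring
  have hinv : PowerSeries.constantCoeff (localInv ξ) = ξ⁻¹ := by simp [localInv]
  rw [hsum, hinv, mul_left_comm] at h0
  have h1 := mul_left_cancel₀ hden h0
  have hrho : PowerSeries.constantCoeff (denomSeries b ξ) = (1 - ξ) / (phase b ξ 1 - 1) :=
    eq_div_of_mul_eq hφ (denomSeries_mul hb hpos)
  rw [hrho] at h1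
  obtain ⟨κ, hκ0, hκ⟩ := exists_sum_framing_eq hb hξ hr
  rw [h1, oddSum_A_eq hξ hk hκ, FUnknot_eq hξ (by omega) hκ, inv_pow, pow_succ ξ]
  have hξk : ξ ^ ((k + 1).choose 2) ≠ 0 := pow_ne_zero _ hξ0
  field_simp

end Family

end

end LaplaceTransform

/-! ### Conclusion: the interpolating element -/

theorem theorem2p3 (b : ℤ)
    (hb : b = 1 ∨ b = -1 ∨
      ∃ p l : ℕ, p.Prime ∧ 0 < l ∧ (b = (p : ℤ) ^ l ∨ b = -(p : ℤ) ^ l))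
    (k : ℕ) :
    ∃ Q : LaplaceTransform.RRing b,
      (∀ (ξ : ℂ) (r : ℕ) (hξ : IsPrimitiveRoot ξ r) (hr : Odd r), (2 * k + 1 < r ∨ k = 0) →
        LaplaceTransform.FUnknot b ξ r ≠ 0 ∧
        LaplaceTransform.oddSum ξ r
            (fun n => LaplaceTransform.framing b n * LaplaceTransform.A n k) /
            LaplaceTransform.FUnknot b ξ r
          = LaplaceTransform.evR b hξ hr Q) ∧
      (Odd b → ∃ Q' : LaplaceTransform.SRing b, LaplaceTransform.sToR b Q' = Q) := by
  have hpl : ∃ p l : ℕ, p.Prime ∧ b.natAbs = p ^ l := by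
    rcases hb with rfl | rfl | ⟨p, l, hp, _, rfl | rfl⟩
    -- `b = ±1` is treated as `±2^0`: there is a single stratum and nothing to glue.
    · exact ⟨2, 0, Nat.prime_two, by simp⟩
    · exact ⟨2, 0, Nat.prime_two, by simp⟩
    · exact ⟨p, l, hp, by simp [Int.natAbs_pow]⟩
    · exact ⟨p, l, hp, by simp [Int.natAbs_pow]⟩
  obtain ⟨p, l, hp, hpl⟩ := hpl
  have hb0 : b ≠ 0 := by
    rw [← Int.natAbs_ne_zero, hpl]
    exact pow_ne_zero _ hp.ne_zero
  -- For `k = 0` the order `r = 1` is allowed as well. Here `A(n,0) = q^{-1}[n]²`, so the quotient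
  -- is `q^{-1}` for every odd `r`.
  rcases Nat.eq_zero_or_pos k with rfl | hk
  · obtain ⟨Q, hQ⟩ := (LaplaceTransform.realizable_localInv
      (LaplaceTransform.ZInv b) Set.univ).exists_SRing
    refine ⟨LaplaceTransform.sToR b Q, fun ξ r hξ hr _ => ?_, fun _ => ⟨Q, rfl⟩⟩
    have hF := LaplaceTransform.FUnknot_ne_zero hb0 hξ hr
    refine ⟨hF, ?_⟩
    rw [hQ, LaplaceTransform.oddSum_A_zero hξ hr, mul_div_assoc, div_self hF, mul_one]
    simp [LaplaceTransform.localInv]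
  · obtain ⟨G, hG, hGeq⟩ := LaplaceTransform.exists_quotient_family hp hpl k
    obtain ⟨Q, hQ⟩ := hG.exists_SRing
    refine ⟨LaplaceTransform.sToR b Q, fun ξ r hξ hr h => ?_, fun _ => ⟨Q, rfl⟩⟩
    refine ⟨LaplaceTransform.FUnknot_ne_zero hb0 hξ hr, ?_⟩
    have hpos : 0 < orderOf ξ := by
      rw [← hξ.eq_orderOf]
      exact hr.pos
    rw [hQ]
    exact LaplaceTransform.quotient_eq_constantCoeff hb0 hξ hr (by omega) (hGeq ξ hpos)
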